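/- Setting. A connected undirected graph on $N\ge 1$ agents is given, with a mixing matrix $W=(w_{nm})\in[0,1]^{N\times N}$ that is doubly stochastic and satisfies $w_{nm}>0$ if $n=m$ or $n,m$ are neighbours, and $w_{nm}=0$ otherwise. Put $\lambda:=1-\|(I-\frac1N\mathbf 1\mathbf 1^\top)W\|^2$ (spectral norm), and assume $\lambda>0$. Agent $n$ has a data distribution $\mathcal D_n$; the samples $\xi_{n,z}\sim\mathcal D_n$ ($1\le n\le N$, $1\le z\le Z$, $Z\ge1$) are independent and form the dataset $\mathcal S$. For a loss $f(x;\xi)$, $x\in\mathbb R^d$, that is measurable and $\mathcal D_n$-integrable in $\xi$ for every $x$ and every $n$, let $$F(x)=\frac1N\sum_n\mathbb E_{\xi\sim\mathcal D_n}f(x;\xi),\qquad F_{\mathcal S_n}(x)=\frac1Z\sum_z f(x;\xi_{n,z}),\qquad F_{\mathcal S}(x)=\frac1N\sum_nF_{\mathcal S_n}(x),$$ and let $x^*_{\mathcal S}$ be the minimizer of $F_{\mathcal S}$. Algorithm (attack-free DSGD). All agents start at $x_n^0=x^0$. At time $k$ every agent draws $\xi_n^k$ uniformly from its local dataset $\{\xi_{n,1},\dots,\xi_{n,Z}\}$,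 independently of all other draws, and $x_n^{k+1}=\sum_m w_{nm}\bigl(x_m^k-\alpha^k\nabla f(x_m^k;\xi_m^k)\bigr)$. The output is $\bar x^k=\frac1N\sum_n x_n^k$ (so $\bar x^0=x^0$). Assumptions. (1) $f(\cdot;\xi)$ is $\mu$-strongly convex and (2) $L$-smooth for every $\xi$, with $\mu,L>0$. For almost every dataset $\mathcal S$ and all $x\in\mathbb R^d$: (3) $\frac1Z\sum_z\|\nabla f(x;\xi_{n,z})-\nabla F_{\mathcal S_n}(x)\|^2\le\sigma^2$ for every agent $n$; (4) $\frac1N\sum_n\|\nabla F_{\mathcal S_n}(x)-\nabla F_{\mathcal S}(x)\|^2\le\delta^2$. Moreover $\mathbb E_{\mathcal S}\|\bar x^0-x^*_{\mathcal S}\|^2<\infty$. Theorem (generalization error of attack-free DSGD with heterogeneous data). There is a threshold $\kappa$, depending only on $\mu,L,\lambda$, and for all $k_0>0$ and $b\in\mathbb R$, $a>0$ a constant $C>0$ depending only on $L,\lambda,k_0,a,b$, such that the following holds. If $k_0\ge\kappa$, the step sizes are $\alpha^t=\frac1{\mu(t+k_0)}$, and $k\asymp\mu NZ$ in the sense that $a\,\mu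 NZ\le k\le b\,\mu NZ$, then $F(\bar x^k)-F_{\mathcal S}(\bar x^k)$ is integrable and $$\mathbb E_{\mathcal S,\mathcal L}\bigl[F(\bar x^k)-F_{\mathcal S}(\bar x^k)\bigr]\le C\,\frac{\mathbb E_{\mathcal S}\|\bar x^0-x^*_{\mathcal S}\|^2}{\mu NZ}+C\,\frac{\sigma^2\,(1+\ln(NZ))}{\mu NZ}+C\,\frac{\delta^2}{\mu NZ},$$ where the expectation is over the dataset and over the draws of the algorithm. -/

import Mathlib

open MeasureTheory
open scoped BigOperators Gradient

noncomputable section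

namespace DSGD

/-- The model space `ℝ^d` with its Euclidean norm. -/
abbrev Model (d : ℕ) : Type := EuclideanSpace ℝ (Fin d)

/-- A global dataset: `S (n, z)` is the `z`-th training sample of agent `n`. -/
abbrev Dataset (N Z : ℕ) (Ξ : Type*) : Type _ := Fin N × Fin Z → Ξ

/-- First-order form of `μ`-strong convexity (`g` is assumed differentiable where this is used). -/
def StronglyConvex {d : ℕ} (μ : ℝ) (g : Model d → ℝ) : Prop :=
  ∀ x y : Model d, g y + inner ℝ (x - y) (∇ g y) + μ / 2 * ‖x - y‖ ^ 2 ≤ g x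

/-- `L`-smoothness: `g` is differentiable with an `L`-Lipschitz gradient. -/
def Smooth {d : ℕ} (L : ℝ) (g : Model d → ℝ) : Prop :=
  Differentiable ℝ g ∧ ∀ x y : Model d, ‖∇ g x - ∇ g y‖ ≤ L * ‖x - y‖

section Losses

variable {d N Z : ℕ} {Ξ : Type*}

/-- Population loss `F(x) = (1/N) ∑ₙ 𝔼_{ξ ∼ Dₙ} f(x; ξ)`. -/
def popLoss [MeasurableSpace Ξ] (f : Model d → Ξ → ℝ) (D : Fin N → Measure Ξ) (x : Model d) : ℝ :=
  (N : ℝ)⁻¹ * ∑ n, ∫ ξ, f x ξ ∂(D n)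

/-- Local empirical loss `F_{Sₙ}(x) = (1/Z) ∑_z f(x; ξ_{n,z})` of agent `n`. -/
def localLoss (f : Model d → Ξ → ℝ) (S : Dataset N Z Ξ) (n : Fin N) (x : Model d) : ℝ :=
  (Z : ℝ)⁻¹ * ∑ z, f x (S (n, z))

/-- Global empirical loss `F_S(x) = (1/N) ∑ₙ F_{Sₙ}(x)`. -/
def empLoss (f : Model d → Ξ → ℝ) (S : Dataset N Z Ξ) (x : Model d) : ℝ :=
  (N : ℝ)⁻¹ * ∑ n, localLoss f S n x

/-- The minimizer `x*_S` of the global empirical loss; it exists and is unique as soon as the loss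
is differentiable and strongly convex and `N, Z ≥ 1`. -/
def empMinimizer (f : Model d → Ξ → ℝ) (S : Dataset N Z Ξ) : Model d :=
  Classical.epsilon fun x => ∀ y, empLoss f S x ≤ empLoss f S y

/-- Stochastic gradient noise at most `σ²` on the dataset `S`: the variance of the gradient at one
sample drawn uniformly from the local dataset, at every point and for every agent. -/
def NoiseBound (f : Model d → Ξ → ℝ) (S : Dataset N Z Ξ) (σ : ℝ) : Prop :=
  ∀ (x : Model d) (n : Fin N),
    (Z : ℝ)⁻¹ * ∑ z, ‖∇ (fun y => f y (S (n, z))) x - ∇ (localLoss f S n) x‖ ^ 2 ≤ σ ^ 2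

/-- Heterogeneity at most `δ²` on the dataset `S`. -/
def HeterogeneityBound (f : Model d → Ξ → ℝ) (S : Dataset N Z Ξ) (δ : ℝ) : Prop :=
  ∀ x : Model d,
    (N : ℝ)⁻¹ * ∑ n, ‖∇ (localLoss f S n) x - ∇ (empLoss f S) x‖ ^ 2 ≤ δ ^ 2

/-- The law of the dataset: all samples are independent, and `ξ_{n,z} ∼ Dₙ`. -/
def dataLaw [MeasurableSpace Ξ] (Z : ℕ) (D : Fin N → Measure Ξ) : Measure (Dataset N Z Ξ) :=
  Measure.pi fun p : Fin N × Fin Z => D p.1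

end Losses

/-- `W` is a doubly stochastic mixing matrix supported exactly on the edges of the communication
graph and on the diagonal. -/
structure IsMixingMatrix {N : ℕ} (G : SimpleGraph (Fin N)) (W : Matrix (Fin N) (Fin N) ℝ) :
    Prop where
  mem_Icc : ∀ n m, W n m ∈ Set.Icc (0 : ℝ) 1
  row_sum : ∀ n, ∑ m, W n m = 1
  col_sum : ∀ m, ∑ n, W n m = 1
  pos : ∀ n m, G.Adj n m ∨ n = m → 0 < W n m
  zero : ∀ n m, ¬ (G.Adj n m ∨ n = m) → W n m = 0

/-- `λ = 1 - ‖(I - (1/N) 𝟏𝟏ᵀ) W‖²`, with the spectral norm. -/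
def spectralGap {N : ℕ} (W : Matrix (Fin N) (Fin N) ℝ) : ℝ :=
  1 - ‖Matrix.toEuclideanCLM (n := Fin N) (𝕜 := ℝ)
      ((1 - (N : ℝ)⁻¹ • Matrix.of fun _ _ => (1 : ℝ)) * W)‖ ^ 2

section Algorithm

variable {d N Z : ℕ} {Ξ : Type*}

/-- The local models after `k` steps of decentralized SGD on the dataset `S`, started at the common
point `x0`, with step sizes `α`. The argument `I` records the draws: at time `t < k`, agent `n`
uses the sample `S (n, I t n)`. One step is a local gradient step followed by averaging with `W`. -/
def localModels (f : Model d → Ξ → ℝ) (W : Matrix (Fin N) (Fin N) ℝ) (α : ℕ → ℝ)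
    (x0 : Model d) (S : Dataset N Z Ξ) :
    (k : ℕ) → (Fin k → Fin N → Fin Z) → Fin N → Model d
  | 0, _ => fun _ => x0
  | k + 1, I => fun n => ∑ m, W n m •
      (localModels f W α x0 S k (fun t => I t.castSucc) m
        - α k • ∇ (fun y => f y (S (m, I (Fin.last k) m)))
            (localModels f W α x0 S k (fun t => I t.castSucc) m))

/-- The output of the algorithm: the average of the local models after `k` steps. -/
def output (f : Model d → Ξ → ℝ) (W : Matrix (Fin N) (Fin N) ℝ) (α : ℕ → ℝ)
    (x0 : Model d) (S : Dataset N Z Ξ) (k : ℕ) (I : Fin k → Fin N → Fin Z) : Model d :=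
  (N : ℝ)⁻¹ • ∑ n, localModels f W α x0 S k I n

/-- The generalization gap `F(x̄ᵏ) - F_S(x̄ᵏ)` for given data and given draws. -/
def genGap [MeasurableSpace Ξ] (f : Model d → Ξ → ℝ) (D : Fin N → Measure Ξ)
    (W : Matrix (Fin N) (Fin N) ℝ) (α : ℕ → ℝ) (x0 : Model d) (k : ℕ)
    (S : Dataset N Z Ξ) (I : Fin k → Fin N → Fin Z) : ℝ :=
  popLoss f D (output f W α x0 S k I) - empLoss f S (output f W α x0 S k I)

/-- The generalization error `𝔼_{S,𝓛}[F(x̄ᵏ) - F_S(x̄ᵏ)]`: integral over the data, and average over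
the draws, which are independent and uniform (that is, `I` is uniform on its finite type). -/
def genError [MeasurableSpace Ξ] (Z : ℕ) (f : Model d → Ξ → ℝ) (D : Fin N → Measure Ξ)
    (W : Matrix (Fin N) (Fin N) ℝ) (α : ℕ → ℝ) (x0 : Model d) (k : ℕ) : ℝ :=
  ∫ S, (Finset.univ : Finset (Fin k → Fin N → Fin Z)).expect
    (fun I => genGap f D W α x0 k S I) ∂(dataLaw Z D)

end Algorithm

end DSGD

end

/-! The proof is an on-average stability argument in which all distances are measured from the
starting point `x0`. Let `S'` be an independent copy of the data `S`. Exchanging the `i`-th entries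
of `S` and `S'` preserves their joint law, so the mean gap is the mean, also over `i`, of the
increase of the loss at `S i` when training uses `S' i` instead (`integral_genGap_eq`). This
increase is bounded for fixed `S` and `S'` in `expect_loss_update_sub_le`.

Couple the two runs through the same draws, and let `T` be the sum over agents of the distances
between their models. Mixing does not increase `T`, gradient steps contract it, and the replaced
entry acts at one agent only, with probability `1/Z` per step, adding `α` times a gradient
difference. Hence the second moment of `T` is of order `1/(μZ)² + 1/(μ²Zk)` times squared gradients
(`expect_sum_norm_localModels_update_sub_sq_le`). The outputs differ by at most `T/N`, and for `k`
at least of order `μNZ` a Young inequality with weight `μNZ` turns this into an increase of order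
`1/(μNZ)`.

All gradients are referred back to `x0`: averaged over draws and agents, the squared distance to
`x0` never exceeds `3/μ²` times `meanSqGrad` at `x0` (`expect_norm_localModels_sub_sq_le`). Since
the full gradient vanishes at the empirical minimizer, `meanSqGrad` at `x0` is controlled by `σ²`,
`δ²` and the distance from `x0` to that minimizer (`meanSqGrad_le_of_noise_of_heterogeneity`). -/

namespace DSGD

/-! ### Gradient steps and loss increments for one sample loss -/

section OneSample

variable {d : ℕ} {μ L α : ℝ} {g : Model d → ℝ}

theorem StronglyConvex.mul_norm_sq_le_inner (hc : StronglyConvex μ g) (x y : Model d) :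
    μ * ‖x - y‖ ^ 2 ≤ inner ℝ (x - y) (∇ g x - ∇ g y) := by
  have h1 := hc x y
  have h2 := hc y x
  rw [norm_sub_rev y x, ← neg_sub x y, inner_neg_left] at h2
  rw [inner_sub_right]
  linarith

theorem norm_gradStep_sub_sq_le (hc : StronglyConvex μ g) (hs : Smooth L g) (hα : 0 ≤ α)
    (x y : Model d) :
    ‖(x - α • ∇ g x) - (y - α • ∇ g y)‖ ^ 2 ≤
      (1 - 2 * (α * μ) + α ^ 2 * L ^ 2) * ‖x - y‖ ^ 2 := by
  have e : (x - α • ∇ g x) - (y - α • ∇ g y) = (x - y) - α • (∇ g x - ∇ g y) := by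
    rw [smul_sub]; abel
  rw [e, norm_sub_sq_real, inner_smul_right, norm_smul, Real.norm_of_nonneg hα, mul_pow]
  have h1 := mul_le_mul_of_nonneg_left (hc.mul_norm_sq_le_inner x y) hα
  have h2 : ‖∇ g x - ∇ g y‖ ^ 2 ≤ (L * ‖x - y‖) ^ 2 :=
    pow_le_pow_left₀ (norm_nonneg _) (hs.2 x y) 2
  have h3 := mul_le_mul_of_nonneg_left h2 (sq_nonneg α)
  nlinarith

/-- The anchor `p` need not be a minimizer of `g`. Compare with the gradient step from `p`, which
moves `p` by `α • ∇ g p`, and split by Young with parameter `α * μ / 2`; part of the contraction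
pays for the cross term. -/
theorem norm_gradStep_sub_anchor_sq_le (hc : StronglyConvex μ g) (hs : Smooth L g) (hμ : 0 < μ)
    (hα : 0 < α) (h₁ : α * μ ≤ 1 / 2) (h₂ : 4 * (α * L ^ 2) ≤ μ) (x p : Model d) :
    ‖(x - α • ∇ g x) - p‖ ^ 2 ≤ (1 - α * μ) * ‖x - p‖ ^ 2 + 3 * α / μ * ‖∇ g p‖ ^ 2 := by
  have hαμ : 0 < α * μ := mul_pos hα hμ
  set v : Model d := (x - α • ∇ g x) - (p - α • ∇ g p) with hv
  have e : (x - α • ∇ g x) - p = v - α • ∇ g p := by rw [hv]; abel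
  -- The factor `7 / 4` is `2 - 1 / 4`: the step size condition gives `α ^ 2 * L ^ 2 ≤ α * μ / 4`.
  have hv2 : ‖v‖ ^ 2 ≤ (1 - 7 / 4 * (α * μ)) * ‖x - p‖ ^ 2 := by
    refine (norm_gradStep_sub_sq_le hc hs hα.le x p).trans
      (mul_le_mul_of_nonneg_right ?_ (sq_nonneg _))
    nlinarith
  have h3 : ‖v - α • ∇ g p‖ ^ 2 ≤
      (1 + α * μ / 2) * ‖v‖ ^ 2 + (1 + 2 / (α * μ)) * (α ^ 2 * ‖∇ g p‖ ^ 2) := by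
    have h4 : ‖v - α • ∇ g p‖ ≤ ‖v‖ + α * ‖∇ g p‖ := by
      simpa [norm_smul, abs_of_pos hα] using norm_sub_le v (α • ∇ g p)
    have h5 := pow_le_pow_left₀ (norm_nonneg _) h4 2
    have h6 : 2 * (‖v‖ * (α * ‖∇ g p‖)) ≤
        α * μ / 2 * ‖v‖ ^ 2 + 2 / (α * μ) * (α * ‖∇ g p‖) ^ 2 := by
      have := sq_nonneg (α * μ * ‖v‖ - 2 * (α * ‖∇ g p‖))
      rw [show α * μ / 2 * ‖v‖ ^ 2 + 2 / (α * μ) * (α * ‖∇ g p‖) ^ 2 =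
        ((α * μ * ‖v‖) ^ 2 + (2 * (α * ‖∇ g p‖)) ^ 2) / (2 * (α * μ)) by field_simp,
        le_div_iff₀ (by positivity)]
      nlinarith
    nlinarith
  rw [e]
  refine h3.trans (add_le_add ?_ ?_)
  · refine (mul_le_mul_of_nonneg_left hv2 (by positivity)).trans ?_
    rw [← mul_assoc]
    refine mul_le_mul_of_nonneg_right ?_ (sq_nonneg _)
    nlinarith
  · rw [← mul_assoc]
    refine mul_le_mul_of_nonneg_right ?_ (sq_nonneg _)
    rw [show (1 + 2 / (α * μ)) * α ^ 2 = (α * μ + 2) * α / μ by field_simp]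
    gcongr
    linarith

theorem Smooth.norm_gradient_le (hs : Smooth L g) (x p : Model d) :
    ‖∇ g x‖ ≤ ‖∇ g p‖ + L * ‖x - p‖ := by
  have h := norm_add_le (∇ g p) (∇ g x - ∇ g p)
  rw [add_sub_cancel] at h
  linarith [hs.2 x p]

theorem Smooth.norm_gradient_sq_le (hs : Smooth L g) (x p : Model d) :
    ‖∇ g x‖ ^ 2 ≤ 2 * ‖∇ g p‖ ^ 2 + 2 * L ^ 2 * ‖x - p‖ ^ 2 := by
  have h := pow_le_pow_left₀ (norm_nonneg _) (hs.norm_gradient_le x p) 2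
  nlinarith [sq_nonneg (‖∇ g p‖ - L * ‖x - p‖)]

/-- Convexity is used with the tangent at `y`, and the Lipschitz gradient then moves the base point
to `x`. This avoids integrating along the segment, at the price of `L` in place of `L / 2`. -/
theorem sub_le_norm_gradient_mul (hc : StronglyConvex μ g) (hs : Smooth L g) (hμ : 0 ≤ μ)
    (x y : Model d) : g y - g x ≤ ‖∇ g x‖ * ‖y - x‖ + L * ‖y - x‖ ^ 2 := by
  have h1 := hc x y
  have h2 : inner ℝ (y - x) (∇ g y) ≤ ‖y - x‖ * ‖∇ g y‖ := real_inner_le_norm _ _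
  have h3 := mul_le_mul_of_nonneg_left (hs.norm_gradient_le y x) (norm_nonneg (y - x))
  rw [← neg_sub y x, inner_neg_left, norm_neg] at h1
  have : 0 ≤ μ / 2 * ‖y - x‖ ^ 2 := by positivity
  nlinarith

theorem abs_sub_le_norm_gradient_mul (hc : StronglyConvex μ g) (hs : Smooth L g) (hμ : 0 ≤ μ)
    (hL : 0 ≤ L) (x y : Model d) :
    |g y - g x| ≤ ‖∇ g x‖ * ‖y - x‖ + L * ‖y - x‖ ^ 2 := by
  refine abs_le.2 ⟨?_, sub_le_norm_gradient_mul hc hs hμ x y⟩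
  have h1 := hc y x
  have h2 := (abs_le.1 (abs_real_inner_le_norm (y - x) (∇ g x))).1
  have h3 : 0 ≤ μ / 2 * ‖y - x‖ ^ 2 := by positivity
  have h4 : 0 ≤ L * ‖y - x‖ ^ 2 := by positivity
  linarith [mul_comm ‖∇ g x‖ ‖y - x‖]

end OneSample

/-! ### Mixing is nonexpansive in sums over agents -/

section Mixing

variable {d N : ℕ} {G : SimpleGraph (Fin N)} {W : Matrix (Fin N) (Fin N) ℝ}

theorem IsMixingMatrix.nonneg (hW : IsMixingMatrix G W) (n m : Fin N) : 0 ≤ W n m :=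
  (hW.mem_Icc n m).1

theorem IsMixingMatrix.norm_mix_le (hW : IsMixingMatrix G W) (v : Fin N → Model d) (n : Fin N) :
    ‖∑ m, W n m • v m‖ ≤ ∑ m, W n m * ‖v m‖ := by
  refine (norm_sum_le _ _).trans (Finset.sum_le_sum fun m _ => ?_)
  rw [norm_smul, Real.norm_of_nonneg (hW.nonneg n m)]

theorem IsMixingMatrix.sum_mix (hW : IsMixingMatrix G W) (a : Fin N → ℝ) :
    ∑ n, ∑ m, W n m * a m = ∑ m, a m := by
  rw [Finset.sum_comm]
  exact Finset.sum_congr rfl fun m _ => by rw [← Finset.sum_mul, hW.col_sum, one_mul]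

theorem IsMixingMatrix.sum_norm_mix_le (hW : IsMixingMatrix G W) (v : Fin N → Model d) :
    ∑ n, ‖∑ m, W n m • v m‖ ≤ ∑ m, ‖v m‖ :=
  (Finset.sum_le_sum fun n _ => hW.norm_mix_le v n).trans (hW.sum_mix _).le

theorem IsMixingMatrix.sum_norm_mix_sq_le (hW : IsMixingMatrix G W) (v : Fin N → Model d) :
    ∑ n, ‖∑ m, W n m • v m‖ ^ 2 ≤ ∑ m, ‖v m‖ ^ 2 := by
  refine (Finset.sum_le_sum fun n _ => ?_).trans (hW.sum_mix fun m => ‖v m‖ ^ 2).le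
  refine (pow_le_pow_left₀ (norm_nonneg _) (hW.norm_mix_le v n) 2).trans ?_
  exact Real.pow_arith_mean_le_arith_mean_pow _ _ _ (fun m _ => hW.nonneg n m) (hW.row_sum n)
    (fun m _ => norm_nonneg _) 2

end Mixing

/-! ### Uniform draws: the last draw and the marginals -/

section Draws

theorem expect_fin_succ {k : ℕ} {X : Type*} [Fintype X] (Φ : (Fin k → X) → X → ℝ) :
    (𝔼 I : Fin (k + 1) → X, Φ (fun t => I t.castSucc) (I (Fin.last k))) =
      𝔼 J : Fin k → X, 𝔼 x : X, Φ J x := by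
  rw [Finset.expect_comm, ← Finset.expect_product', Finset.univ_product_univ]
  refine Fintype.expect_equiv (Fin.snocEquiv fun _ => X).symm _ _ fun I => ?_
  rfl

theorem expect_eval {ι β : Type*} [Fintype ι] [DecidableEq ι] [Fintype β] [Nonempty β]
    (m : ι) (ψ : β → ℝ) : (𝔼 x : ι → β, ψ (x m)) = 𝔼 z, ψ z := by
  rw [Fintype.expect_equiv (Equiv.funSplitAt m β) (fun x => ψ (x m)) (fun p => ψ p.1)
    (fun x => rfl), ← Finset.univ_product_univ,
    Finset.expect_product' Finset.univ Finset.univ fun (z : β) (_ : { j // j ≠ m } → β) => ψ z]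
  exact Finset.expect_congr rfl fun z _ => Fintype.expect_const _

end Draws

/-! ### Distance to the starting point, and distance between two coupled runs -/

section Trajectories

variable {d N Z : ℕ} {Ξ : Type*} {f : Model d → Ξ → ℝ} {G : SimpleGraph (Fin N)}
  {W : Matrix (Fin N) (Fin N) ℝ} {α : ℕ → ℝ} {μ L : ℝ}

/-- Each step yields `u ↦ (1 - α μ) u + 3 α w / μ`, whose fixed point `3 w / μ ^ 2` is the same for
every step size, so the bound is an invariant of the recursion. The current draw is independent of
the past, which replaces the sample gradient at `x0` by its average. -/
theorem expect_sum_norm_localModels_sub_sq_le [Nonempty (Fin Z)] (hW : IsMixingMatrix G W)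
    (hc : ∀ ξ, StronglyConvex μ fun x => f x ξ) (hs : ∀ ξ, Smooth L fun x => f x ξ) (hμ : 0 < μ)
    (hα : ∀ t, 0 < α t) (h₁ : ∀ t, α t * μ ≤ 1 / 2) (h₂ : ∀ t, 4 * (α t * L ^ 2) ≤ μ)
    (x0 : Model d) (S : Dataset N Z Ξ) (k : ℕ) :
    (𝔼 I : Fin k → Fin N → Fin Z, ∑ n, ‖localModels f W α x0 S k I n - x0‖ ^ 2) ≤
      3 / μ ^ 2 * ∑ n, 𝔼 z, ‖∇ (fun y => f y (S (n, z))) x0‖ ^ 2 := by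
  induction k with
  | zero =>
    simp only [localModels, sub_self, norm_zero, ne_eq, OfNat.ofNat_ne_zero, not_false_eq_true,
      zero_pow, Finset.sum_const_zero, Finset.expect_const_zero]
    exact mul_nonneg (by positivity)
      (Finset.sum_nonneg fun n _ => Finset.expect_nonneg fun z _ => sq_nonneg _)
  | succ k ih =>
    set w := ∑ n, 𝔼 z, ‖∇ (fun y => f y (S (n, z))) x0‖ ^ 2 with hw
    let Φ : (Fin k → Fin N → Fin Z) → (Fin N → Fin Z) → ℝ := fun J x =>
      ∑ m, ‖(localModels f W α x0 S k J m
        - α k • ∇ (fun y => f y (S (m, x m))) (localModels f W α x0 S k J m)) - x0‖ ^ 2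
    have hstep : ∀ J, (𝔼 x, Φ J x) ≤
        (1 - α k * μ) * ∑ n, ‖localModels f W α x0 S k J n - x0‖ ^ 2 + 3 * α k / μ * w := by
      intro J
      rw [Finset.expect_sum_comm, hw, Finset.mul_sum, Finset.mul_sum, ← Finset.sum_add_distrib]
      refine Finset.sum_le_sum fun m _ => ?_
      rw [expect_eval m fun z => ‖(localModels f W α x0 S k J m
        - α k • ∇ (fun y => f y (S (m, z))) (localModels f W α x0 S k J m)) - x0‖ ^ 2]
      refine (Finset.expect_le_expect fun z _ => norm_gradStep_sub_anchor_sq_le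
        (hc (S (m, z))) (hs (S (m, z))) hμ (hα k) (h₁ k) (h₂ k) _ x0).trans ?_
      rw [Finset.expect_add_distrib, Fintype.expect_const, Finset.mul_expect]
    calc (𝔼 I : Fin (k + 1) → Fin N → Fin Z,
          ∑ n, ‖localModels f W α x0 S (k + 1) I n - x0‖ ^ 2)
        ≤ 𝔼 I : Fin (k + 1) → Fin N → Fin Z, Φ (fun t => I t.castSucc) (I (Fin.last k)) := by
          refine Finset.expect_le_expect fun I _ => ?_
          refine le_trans (le_of_eq ?_) (hW.sum_norm_mix_sq_le _)
          refine Finset.sum_congr rfl fun n _ => ?_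
          simp only [localModels]
          -- The rows of `W` sum to one, so the anchor `x0` is itself a mixture of copies of `x0`.
          simp_rw [smul_sub _ _ x0]
          rw [Finset.sum_sub_distrib, ← Finset.sum_smul, hW.row_sum, one_smul]
      _ = 𝔼 J, 𝔼 x, Φ J x := expect_fin_succ Φ
      _ ≤ 𝔼 J : Fin k → Fin N → Fin Z, ((1 - α k * μ) *
            ∑ n, ‖localModels f W α x0 S k J n - x0‖ ^ 2 + 3 * α k / μ * w) :=
          Finset.expect_le_expect fun J _ => hstep J
      _ = (1 - α k * μ) * (𝔼 J : Fin k → Fin N → Fin Z,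
            ∑ n, ‖localModels f W α x0 S k J n - x0‖ ^ 2) + 3 * α k / μ * w := by
          rw [Finset.expect_add_distrib, Fintype.expect_const, ← Finset.mul_expect]
      _ ≤ (1 - α k * μ) * (3 / μ ^ 2 * w) + 3 * α k / μ * w :=
          add_le_add_left (mul_le_mul_of_nonneg_left ih (by linarith [h₁ k])) _
      _ = 3 / μ ^ 2 * w := by field_simp; ring

/-- Growth of the distance between two runs whose datasets differ in the entry `i` only: all steps
contract, and a step that draws the entry `i` adds a gradient difference. -/
theorem sum_norm_localModels_update_sub_le (hW : IsMixingMatrix G W)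
    (hc : ∀ ξ, StronglyConvex μ fun x => f x ξ) (hs : ∀ ξ, Smooth L fun x => f x ξ)
    (hα : ∀ t, 0 < α t) (h₁ : ∀ t, α t * μ ≤ 1 / 2) (h₂ : ∀ t, 4 * (α t * L ^ 2) ≤ μ)
    (x0 : Model d) (S : Dataset N Z Ξ) (i : Fin N × Fin Z) (ξ : Ξ) (k : ℕ)
    (I : Fin (k + 1) → Fin N → Fin Z) :
    (∑ n, ‖localModels f W α x0 (Function.update S i ξ) (k + 1) I n
        - localModels f W α x0 S (k + 1) I n‖) ≤
      √(1 - 7 / 4 * (α k * μ)) *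
        (∑ n, ‖localModels f W α x0 (Function.update S i ξ) k (fun t => I t.castSucc) n
          - localModels f W α x0 S k (fun t => I t.castSucc) n‖) +
      if I (Fin.last k) i.1 = i.2 then
        α k * (‖∇ (fun y => f y (S i)) x0‖ + ‖∇ (fun y => f y ξ) x0‖
          + 2 * L * ‖localModels f W α x0 S k (fun t => I t.castSucc) i.1 - x0‖)
      else 0 := by
  set S' := Function.update S i ξ with hS'
  set J : Fin k → Fin N → Fin Z := fun t => I t.castSucc with hJ
  set X := localModels f W α x0 S k J with hX
  set X' := localModels f W α x0 S' k J with hX'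
  set c := √(1 - 7 / 4 * (α k * μ)) with hcdef
  set h := ‖∇ (fun y => f y (S i)) x0‖ + ‖∇ (fun y => f y ξ) x0‖ + 2 * L * ‖X i.1 - x0‖ with hh
  have hcontr : ∀ (ζ : Ξ) (x y : Model d), ‖(x - α k • ∇ (fun y => f y ζ) x)
      - (y - α k • ∇ (fun y => f y ζ) y)‖ ≤ c * ‖x - y‖ := by
    intro ζ x y
    have h0 : 0 ≤ 1 - 7 / 4 * (α k * μ) := by linarith [h₁ k]
    refine abs_le_of_sq_le_sq' ?_ (by positivity) |>.2
    rw [mul_pow, hcdef, Real.sq_sqrt h0]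
    refine (norm_gradStep_sub_sq_le (hc ζ) (hs ζ) (hα k).le x y).trans
      (mul_le_mul_of_nonneg_right ?_ (sq_nonneg _))
    have := mul_le_mul_of_nonneg_left (h₂ k) (hα k).le
    nlinarith
  have hagent : ∀ m, ‖(X' m - α k • ∇ (fun y => f y (S' (m, I (Fin.last k) m))) (X' m))
      - (X m - α k • ∇ (fun y => f y (S (m, I (Fin.last k) m))) (X m))‖ ≤
      c * ‖X' m - X m‖ +
        if m = i.1 then (if I (Fin.last k) i.1 = i.2 then α k * h else 0) else 0 := by
    intro m
    by_cases hm : (m, I (Fin.last k) m) = i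
    · have hm1 : m = i.1 := congrArg Prod.fst hm
      subst hm1
      have hm2 : I (Fin.last k) i.1 = i.2 := congrArg Prod.snd hm
      rw [if_pos rfl, if_pos hm2, hm, hS', Function.update_self]
      have e : (X' i.1 - α k • ∇ (fun y => f y ξ) (X' i.1))
          - (X i.1 - α k • ∇ (fun y => f y (S i)) (X i.1)) =
          ((X' i.1 - α k • ∇ (fun y => f y ξ) (X' i.1))
            - (X i.1 - α k • ∇ (fun y => f y ξ) (X i.1)))
          + α k • (∇ (fun y => f y (S i)) (X i.1) - ∇ (fun y => f y ξ) (X i.1)) := by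
        rw [smul_sub]; abel
      rw [e]
      refine (norm_add_le _ _).trans (add_le_add (hcontr _ _ _) ?_)
      rw [norm_smul, Real.norm_of_nonneg (hα k).le]
      refine mul_le_mul_of_nonneg_left ((norm_sub_le _ _).trans ?_) (hα k).le
      linarith [(hs (S i)).norm_gradient_le (X i.1) x0, (hs ξ).norm_gradient_le (X i.1) x0]
    · have e0 : (if m = i.1 then (if I (Fin.last k) i.1 = i.2 then α k * h else 0) else 0) = 0 := by
        split_ifs with h1 h2
        · exact absurd (Prod.ext h1 (h1 ▸ h2)) hm
        · rfl
        · rfl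
      rw [e0, add_zero, hS', Function.update_of_ne hm]
      exact hcontr _ _ _
  calc _ ≤ ∑ m, ‖(X' m - α k • ∇ (fun y => f y (S' (m, I (Fin.last k) m))) (X' m))
        - (X m - α k • ∇ (fun y => f y (S (m, I (Fin.last k) m))) (X m))‖ := by
        refine le_trans (le_of_eq ?_) (hW.sum_norm_mix_le _)
        refine Finset.sum_congr rfl fun n _ => ?_
        simp only [localModels]
        simp_rw [smul_sub (W n _)]
        rw [← Finset.sum_sub_distrib]
    _ ≤ _ := Finset.sum_le_sum fun m _ => hagent m
    _ = _ := by
        rw [Finset.sum_add_distrib, ← Finset.mul_sum, Finset.sum_ite_eq' Finset.univ i.1]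
        simp

/-- On squaring, the cross term `2 c T α h` carries the probability `1 / Z`. Young takes `α μ / 4`
from the contraction, lowering its rate from `7 / 4` to `3 / 2`, and leaves a forcing with `1 / Z ^
2`. The square of the forcing has only one factor `1 / Z` but a second factor `α`. -/
theorem expect_sum_norm_localModels_update_sub_sq_succ_le [Nonempty (Fin Z)]
    (hW : IsMixingMatrix G W)
    (hc : ∀ ξ, StronglyConvex μ fun x => f x ξ) (hs : ∀ ξ, Smooth L fun x => f x ξ) (hμ : 0 < μ)
    (hL : 0 ≤ L)
    (hα : ∀ t, 0 < α t) (h₁ : ∀ t, α t * μ ≤ 1 / 2) (h₂ : ∀ t, 4 * (α t * L ^ 2) ≤ μ)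
    (x0 : Model d) (S : Dataset N Z Ξ) (i : Fin N × Fin Z) (ξ : Ξ) (k : ℕ) :
    (𝔼 I : Fin (k + 1) → Fin N → Fin Z,
      (∑ n, ‖localModels f W α x0 (Function.update S i ξ) (k + 1) I n
        - localModels f W α x0 S (k + 1) I n‖) ^ 2) ≤
      (1 - 3 / 2 * (α k * μ)) * (𝔼 I : Fin k → Fin N → Fin Z,
        (∑ n, ‖localModels f W α x0 (Function.update S i ξ) k I n
          - localModels f W α x0 S k I n‖) ^ 2) +
      (4 * α k / (μ * Z ^ 2) + α k ^ 2 / Z) * 𝔼 I : Fin k → Fin N → Fin Z,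
        (‖∇ (fun y => f y (S i)) x0‖ + ‖∇ (fun y => f y ξ) x0‖
          + 2 * L * ‖localModels f W α x0 S k I i.1 - x0‖) ^ 2 := by
  set T : (Fin k → Fin N → Fin Z) → ℝ := fun J =>
    ∑ n, ‖localModels f W α x0 (Function.update S i ξ) k J n - localModels f W α x0 S k J n‖
    with hT
  set h : (Fin k → Fin N → Fin Z) → ℝ := fun J =>
    ‖∇ (fun y => f y (S i)) x0‖ + ‖∇ (fun y => f y ξ) x0‖
      + 2 * L * ‖localModels f W α x0 S k J i.1 - x0‖ with hh
  set c := √(1 - 7 / 4 * (α k * μ)) with hcdef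
  have hαk := hα k
  have hαμ : 0 < α k * μ := mul_pos hαk hμ
  have hZ : 0 < (Z : ℝ) := by
    have : 0 < Z := Fin.pos_iff_nonempty.2 inferInstance
    exact_mod_cast this
  have hc2 : c ^ 2 = 1 - 7 / 4 * (α k * μ) := Real.sq_sqrt (by linarith [h₁ k])
  have hc0 : 0 ≤ c := Real.sqrt_nonneg _
  have hc1 : c ≤ 1 := by nlinarith
  let Φ : (Fin k → Fin N → Fin Z) → (Fin N → Fin Z) → ℝ := fun J x =>
    (c * T J + if x i.1 = i.2 then α k * h J else 0) ^ 2
  have hstep : ∀ J, (𝔼 x, Φ J x) ≤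
      (1 - 3 / 2 * (α k * μ)) * T J ^ 2 + (4 * α k / (μ * Z ^ 2) + α k ^ 2 / Z) * h J ^ 2 := by
    intro J
    have hT0 : 0 ≤ T J := Finset.sum_nonneg fun _ _ => norm_nonneg _
    have hh0 : 0 ≤ h J := by simp only [hh]; positivity
    rw [expect_eval i.1 fun z => (c * T J + if z = i.2 then α k * h J else 0) ^ 2]
    have e : ∀ z : Fin Z, (c * T J + if z = i.2 then α k * h J else 0) ^ 2 =
        (c * T J) ^ 2 + if z = i.2 then 2 * (c * T J) * (α k * h J) + (α k * h J) ^ 2 else 0 := by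
      intro z; split_ifs <;> ring
    simp_rw [e]
    rw [Finset.expect_add_distrib, Fintype.expect_const, Fintype.expect_eq_sum_div_card,
      Finset.sum_ite_eq' Finset.univ i.2, if_pos (Finset.mem_univ _), Fintype.card_fin, mul_pow,
      hc2]
    have hy : 2 * (c * T J) * (α k * h J) / Z ≤
        α k * μ / 4 * T J ^ 2 + 4 * α k / (μ * Z ^ 2) * h J ^ 2 := by
      have h3 : 2 * (c * T J) * (α k * h J) / Z ≤ 2 * T J * (α k * h J) / Z := by
        gcongr
        nlinarith
      have h4 := sq_nonneg (μ * Z * T J - 4 * h J)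
      refine h3.trans ?_
      rw [show α k * μ / 4 * T J ^ 2 + 4 * α k / (μ * Z ^ 2) * h J ^ 2 =
        α k * ((μ * Z * T J) ^ 2 + (4 * h J) ^ 2) / (4 * μ * Z ^ 2) by field_simp,
        div_le_div_iff₀ hZ (by positivity)]
      have h5 : 0 ≤ α k * Z * (μ * Z * T J - 4 * h J) ^ 2 := by positivity
      nlinarith
    rw [add_div, add_mul, show (α k * h J) ^ 2 / Z = α k ^ 2 / Z * h J ^ 2 by ring]
    linarith
  calc _ ≤ 𝔼 I : Fin (k + 1) → Fin N → Fin Z, Φ (fun t => I t.castSucc) (I (Fin.last k)) := by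
        refine Finset.expect_le_expect fun I _ => pow_le_pow_left₀
          (Finset.sum_nonneg fun _ _ => norm_nonneg _) ?_ 2
        exact sum_norm_localModels_update_sub_le hW hc hs hα h₁ h₂ x0 S i ξ k I
    _ = 𝔼 J, 𝔼 x, Φ J x := expect_fin_succ Φ
    _ ≤ _ := Finset.expect_le_expect fun J _ => hstep J
    _ = _ := by rw [Finset.expect_add_distrib, ← Finset.mul_expect, ← Finset.mul_expect]

end Trajectories

/-! ### Averages over samples, and the scalar recursion -/

theorem expect_prod_eq {N Z : ℕ} (g : Fin N × Fin Z → ℝ) :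
    (𝔼 i, g i) = (N : ℝ)⁻¹ * ∑ n, 𝔼 z, g (n, z) := by
  rw [← Finset.univ_product_univ, Finset.expect_product, Fintype.expect_eq_sum_div_card,
    Fintype.card_fin, div_eq_inv_mul]

theorem expect_fst {N Z : ℕ} [Nonempty (Fin Z)] (g : Fin N → ℝ) :
    (𝔼 i : Fin N × Fin Z, g i.1) = (N : ℝ)⁻¹ * ∑ n, g n := by
  rw [expect_prod_eq fun i : Fin N × Fin Z => g i.1]
  simp only [Fintype.expect_const]

/-- A contraction at rate `3 / (2 s)` with forcing `A / s + B / s ^ 2` stays below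
`A + 2 B / s`. -/
theorem le_add_div_of_rec {u : ℕ → ℝ} {k₀ A B : ℝ} (hk₀ : 2 ≤ k₀) (hA : 0 ≤ A) (hB : 0 ≤ B)
    (h0 : u 0 ≤ 0)
    (hu : ∀ t : ℕ, u (t + 1) ≤ (1 - 3 / 2 * (1 / (t + k₀))) * u t + (A / (t + k₀)
      + B / (t + k₀) ^ 2)) (t : ℕ) : u t ≤ A + 2 * B / (t + k₀) := by
  induction t with
  | zero => exact h0.trans (by positivity)
  | succ t ih =>
    have ht : 0 ≤ (t : ℝ) := Nat.cast_nonneg t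
    push_cast
    set s : ℝ := t + k₀ with hs
    have hs2 : 2 ≤ s := by linarith
    have hs0 : 0 < s := by linarith
    have h1 : 0 ≤ 1 - 3 / 2 * (1 / s) := by
      rw [sub_nonneg, mul_one_div, div_le_one hs0]
      linarith
    refine (hu t).trans ((add_le_add_left (mul_le_mul_of_nonneg_left ih h1) _).trans ?_)
    rw [show (t : ℝ) + 1 + k₀ = s + 1 by rw [hs]; ring]
    -- The slack is positive because the rate `3 / 2` exceeds one; at rate exactly one the forcing
    -- `B / s ^ 2` would accumulate to order `log s / s`.
    have e : A + 2 * B / (s + 1)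
        - ((1 - 3 / 2 * (1 / s)) * (A + 2 * B / s) + (A / s + B / s ^ 2)) =
        (A * s * (s + 1) + 4 * B) / (2 * s ^ 2 * (s + 1)) := by
      field_simp; ring
    have : 0 ≤ (A * s * (s + 1) + 4 * B) / (2 * s ^ 2 * (s + 1)) := by positivity
    linarith

/-- The mean squared norm of the sample gradients at `x`. -/
noncomputable def meanSqGrad {d N Z : ℕ} {Ξ : Type*} (f : Model d → Ξ → ℝ) (x : Model d)
    (S : Dataset N Z Ξ) : ℝ :=
  𝔼 i, ‖∇ (fun y => f y (S i)) x‖ ^ 2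

theorem meanSqGrad_nonneg {d N Z : ℕ} {Ξ : Type*} (f : Model d → Ξ → ℝ) (x : Model d)
    (S : Dataset N Z Ξ) : 0 ≤ meanSqGrad f x S :=
  Finset.expect_nonneg fun _ _ => sq_nonneg _

/-! ### The step sizes satisfy the smallness conditions -/

section StepSizes

variable {μ L k₀ : ℝ}

theorem stepSize_pos (hμ : 0 < μ) (hk : 2 + 4 * L ^ 2 / μ ^ 2 ≤ k₀) (t : ℕ) :
    0 < 1 / (μ * ((t : ℝ) + k₀)) := by
  have : 0 ≤ 4 * L ^ 2 / μ ^ 2 := by positivity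
  have : 0 < k₀ := by linarith
  positivity

theorem stepSize_mul_le_half (hμ : 0 < μ) (hk : 2 + 4 * L ^ 2 / μ ^ 2 ≤ k₀) (t : ℕ) :
    1 / (μ * ((t : ℝ) + k₀)) * μ ≤ 1 / 2 := by
  have : 0 ≤ 4 * L ^ 2 / μ ^ 2 := by positivity
  have ht : 0 ≤ (t : ℝ) := Nat.cast_nonneg t
  have hs : 2 ≤ (t : ℝ) + k₀ := by linarith
  rw [show 1 / (μ * ((t : ℝ) + k₀)) * μ = 1 / ((t : ℝ) + k₀) by field_simp]
  exact one_div_le_one_div_of_le two_pos hs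

theorem four_mul_stepSize_mul_sq_le (hμ : 0 < μ) (hk : 2 + 4 * L ^ 2 / μ ^ 2 ≤ k₀) (t : ℕ) :
    4 * (1 / (μ * ((t : ℝ) + k₀)) * L ^ 2) ≤ μ := by
  have h0 : 0 ≤ 4 * L ^ 2 / μ ^ 2 := by positivity
  have ht : 0 ≤ (t : ℝ) := Nat.cast_nonneg t
  have hs : 0 < (t : ℝ) + k₀ := by linarith
  have h1 : 4 * L ^ 2 / μ ^ 2 ≤ (t : ℝ) + k₀ := by linarith
  rw [div_le_iff₀ (by positivity)] at h1
  rw [show 4 * (1 / (μ * ((t : ℝ) + k₀)) * L ^ 2) = 4 * L ^ 2 / (μ * ((t : ℝ) + k₀)) by ring,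
    div_le_iff₀ (by positivity)]
  linarith

end StepSizes

/-! ### Stability under replacement of one sample -/

section Stability

variable {d N Z : ℕ} {Ξ : Type*} {f : Model d → Ξ → ℝ} {G : SimpleGraph (Fin N)}
  {W : Matrix (Fin N) (Fin N) ℝ} {α : ℕ → ℝ} {μ L : ℝ}

theorem expect_norm_localModels_sub_sq_le [Nonempty (Fin Z)] (hW : IsMixingMatrix G W)
    (hc : ∀ ξ, StronglyConvex μ fun x => f x ξ) (hs : ∀ ξ, Smooth L fun x => f x ξ) (hμ : 0 < μ)
    (hα : ∀ t, 0 < α t) (h₁ : ∀ t, α t * μ ≤ 1 / 2) (h₂ : ∀ t, 4 * (α t * L ^ 2) ≤ μ)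
    (x0 : Model d) (S : Dataset N Z Ξ) (k : ℕ) :
    ((N : ℝ)⁻¹ * 𝔼 I : Fin k → Fin N → Fin Z,
        ∑ n, ‖localModels f W α x0 S k I n - x0‖ ^ 2) ≤
      3 / μ ^ 2 * meanSqGrad f x0 S := by
  rw [meanSqGrad, expect_prod_eq, mul_left_comm]
  exact mul_le_mul_of_nonneg_left
    (expect_sum_norm_localModels_sub_sq_le hW hc hs hμ hα h₁ h₂ x0 S k) (by positivity)

theorem norm_mean_sq_le (v : Fin N → Model d) :
    ‖(N : ℝ)⁻¹ • ∑ n, v n‖ ^ 2 ≤ (N : ℝ)⁻¹ * ∑ n, ‖v n‖ ^ 2 := by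
  rcases Nat.eq_zero_or_pos N with rfl | hN
  · simp
  have hN' : (0 : ℝ) < N := by exact_mod_cast hN
  have h1 : ‖∑ n, v n‖ ^ 2 ≤ N * ∑ n, ‖v n‖ ^ 2 := by
    refine (pow_le_pow_left₀ (norm_nonneg _) (norm_sum_le _ _) 2).trans ?_
    simpa using sq_sum_le_card_mul_sum_sq (s := Finset.univ) (f := fun n => ‖v n‖)
  rw [norm_smul, mul_pow, Real.norm_of_nonneg (by positivity)]
  calc (N : ℝ)⁻¹ ^ 2 * ‖∑ n, v n‖ ^ 2 ≤ (N : ℝ)⁻¹ ^ 2 * (N * ∑ n, ‖v n‖ ^ 2) := by gcongr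
    _ = _ := by field_simp

theorem norm_output_sub_sq_le (hN : 0 < N) (x0 : Model d) (S : Dataset N Z Ξ) (k : ℕ)
    (I : Fin k → Fin N → Fin Z) :
    ‖output f W α x0 S k I - x0‖ ^ 2 ≤
      (N : ℝ)⁻¹ * ∑ n, ‖localModels f W α x0 S k I n - x0‖ ^ 2 := by
  refine le_trans (le_of_eq ?_) (norm_mean_sq_le _)
  have hN' : (N : ℝ) ≠ 0 := by exact_mod_cast hN.ne'
  rw [Finset.sum_sub_distrib, smul_sub, Finset.sum_const, Finset.card_univ, Fintype.card_fin,
    ← Nat.cast_smul_eq_nsmul ℝ, smul_smul, inv_mul_cancel₀ hN', one_smul, output]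

theorem norm_output_sub_output_le (x0 : Model d) (S S' : Dataset N Z Ξ) (k : ℕ)
    (I : Fin k → Fin N → Fin Z) :
    ‖output f W α x0 S' k I - output f W α x0 S k I‖ ≤
      (N : ℝ)⁻¹ * ∑ n, ‖localModels f W α x0 S' k I n - localModels f W α x0 S k I n‖ := by
  rw [output, output, ← smul_sub, ← Finset.sum_sub_distrib, norm_smul,
    Real.norm_of_nonneg (by positivity)]
  exact mul_le_mul_of_nonneg_left (norm_sum_le _ _) (by positivity)

/-- A single sample gradient, or the displacement of a single agent, has no useful bound. The
average over `i` turns them into `meanSqGrad` and the mean displacement of the agents. -/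
theorem expect_perturbation_sq_le [Nonempty (Fin Z)] (hN : 0 < N) (hW : IsMixingMatrix G W)
    (hc : ∀ ξ, StronglyConvex μ fun x => f x ξ) (hs : ∀ ξ, Smooth L fun x => f x ξ) (hμ : 0 < μ)
    (hα : ∀ t, 0 < α t) (h₁ : ∀ t, α t * μ ≤ 1 / 2) (h₂ : ∀ t, 4 * (α t * L ^ 2) ≤ μ)
    (x0 : Model d) (S S' : Dataset N Z Ξ) (k : ℕ) :
    (𝔼 i : Fin N × Fin Z, 𝔼 I : Fin k → Fin N → Fin Z,
      (‖∇ (fun y => f y (S i)) x0‖ + ‖∇ (fun y => f y (S' i)) x0‖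
        + 2 * L * ‖localModels f W α x0 S k I i.1 - x0‖) ^ 2) ≤
      (3 + 36 * L ^ 2 / μ ^ 2) * (meanSqGrad f x0 S + meanSqGrad f x0 S') := by
  have : Nonempty (Fin N) := ⟨⟨0, hN⟩⟩
  have h1 : ∀ (i : Fin N × Fin Z) (I : Fin k → Fin N → Fin Z),
      (‖∇ (fun y => f y (S i)) x0‖ + ‖∇ (fun y => f y (S' i)) x0‖
        + 2 * L * ‖localModels f W α x0 S k I i.1 - x0‖) ^ 2 ≤
      (3 * ‖∇ (fun y => f y (S i)) x0‖ ^ 2 + 3 * ‖∇ (fun y => f y (S' i)) x0‖ ^ 2)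
        + 12 * L ^ 2 * ‖localModels f W α x0 S k I i.1 - x0‖ ^ 2 := by
    intro i I
    set p := ‖∇ (fun y => f y (S i)) x0‖
    set q := ‖∇ (fun y => f y (S' i)) x0‖
    set r := ‖localModels f W α x0 S k I i.1 - x0‖
    nlinarith [sq_nonneg (p - q), sq_nonneg (p - 2 * L * r), sq_nonneg (q - 2 * L * r)]
  refine (Finset.expect_le_expect fun i _ => Finset.expect_le_expect fun I _ => h1 i I).trans ?_
  simp_rw [Finset.expect_add_distrib, Fintype.expect_const, ← Finset.mul_expect]
  rw [expect_fst fun n => 𝔼 I : Fin k → Fin N → Fin Z,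
    ‖localModels f W α x0 S k I n - x0‖ ^ 2, ← Finset.expect_sum_comm]
  have h2 := mul_le_mul_of_nonneg_left
    (expect_norm_localModels_sub_sq_le hW hc hs hμ hα h₁ h₂ x0 S k)
    (show 0 ≤ 12 * L ^ 2 by positivity)
  have h3 : 0 ≤ 36 * L ^ 2 / μ ^ 2 * meanSqGrad f x0 S' :=
    mul_nonneg (by positivity) (meanSqGrad_nonneg f x0 S')
  have h4 : 12 * L ^ 2 * (3 / μ ^ 2 * meanSqGrad f x0 S) =
    36 * L ^ 2 / μ ^ 2 * meanSqGrad f x0 S := by ring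
  rw [h4] at h2
  simp only [meanSqGrad] at h2 h3 ⊢
  linarith

/-- On-average stability of decentralized SGD under the replacement of one sample. -/
theorem expect_sum_norm_localModels_update_sub_sq_le (hN : 0 < N) (hZ : 0 < Z)
    (hW : IsMixingMatrix G W)
    (hc : ∀ ξ, StronglyConvex μ fun x => f x ξ) (hs : ∀ ξ, Smooth L fun x => f x ξ) (hμ : 0 < μ)
    (hL : 0 ≤ L) {k₀ : ℝ} (hk₀ : 2 + 4 * L ^ 2 / μ ^ 2 ≤ k₀)
    (x0 : Model d) (S S' : Dataset N Z Ξ) (k : ℕ) :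
    (𝔼 i : Fin N × Fin Z, 𝔼 I : Fin k → Fin N → Fin Z,
      (∑ n, ‖localModels f W (fun t => 1 / (μ * (t + k₀))) x0 (Function.update S i (S' i)) k I n
        - localModels f W (fun t => 1 / (μ * (t + k₀))) x0 S k I n‖) ^ 2) ≤
      (4 / (μ ^ 2 * Z ^ 2) + 2 / (μ ^ 2 * Z * (k + k₀))) *
        ((3 + 36 * L ^ 2 / μ ^ 2) * (meanSqGrad f x0 S + meanSqGrad f x0 S')) := by
  have : Nonempty (Fin Z) := ⟨⟨0, hZ⟩⟩
  have hZ' : 0 < (Z : ℝ) := by exact_mod_cast hZ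
  have h2k : 2 ≤ k₀ := le_trans (by linarith [show 0 ≤ 4 * L ^ 2 / μ ^ 2 by positivity]) hk₀
  set H := (3 + 36 * L ^ 2 / μ ^ 2) * (meanSqGrad f x0 S + meanSqGrad f x0 S') with hH
  have hH0 : 0 ≤ H := mul_nonneg (by positivity)
    (add_nonneg (meanSqGrad_nonneg _ _ _) (meanSqGrad_nonneg _ _ _))
  set α : ℕ → ℝ := fun t => 1 / (μ * (t + k₀)) with hαdef
  have hα : ∀ t, 0 < α t := stepSize_pos hμ hk₀
  have h₁ : ∀ t, α t * μ ≤ 1 / 2 := stepSize_mul_le_half hμ hk₀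
  have h₂ : ∀ t, 4 * (α t * L ^ 2) ≤ μ := four_mul_stepSize_mul_sq_le hμ hk₀
  refine (le_add_div_of_rec (u := fun k => 𝔼 i : Fin N × Fin Z, 𝔼 I : Fin k → Fin N → Fin Z,
      (∑ n, ‖localModels f W α x0 (Function.update S i (S' i)) k I n
        - localModels f W α x0 S k I n‖) ^ 2) (k₀ := k₀) (A := 4 / (μ ^ 2 * Z ^ 2) * H)
      (B := 1 / (μ ^ 2 * Z) * H) h2k (by positivity) (by positivity) ?_ (fun t => ?_) k).trans
      (le_of_eq ?_)
  · simp [localModels]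
  · have hst : 0 < (t : ℝ) + k₀ := by positivity
    have hαt := hα t
    have key := mul_le_mul_of_nonneg_left
      (expect_perturbation_sq_le hN hW hc hs hμ hα h₁ h₂ x0 S S' t)
      (show 0 ≤ 4 * α t / (μ * Z ^ 2) + α t ^ 2 / Z by positivity)
    have e1 : 3 / 2 * (1 / ((t : ℝ) + k₀)) = 3 / 2 * (α t * μ) := by
      simp only [hαdef]; field_simp
    have e2 : 4 / (μ ^ 2 * Z ^ 2) * H / ((t : ℝ) + k₀) + 1 / (μ ^ 2 * Z) * H / ((t : ℝ) + k₀) ^ 2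
        = (4 * α t / (μ * Z ^ 2) + α t ^ 2 / Z) * H := by
      simp only [hαdef]; field_simp
    rw [e1, e2]
    refine (Finset.expect_le_expect fun i _ =>
      expect_sum_norm_localModels_update_sub_sq_succ_le hW hc hs hμ hL hα h₁ h₂ x0 S i (S' i)
        t).trans ?_
    rw [Finset.expect_add_distrib, ← Finset.mul_expect, ← Finset.mul_expect]
    exact add_le_add_right key _
  · have hst : 0 < (k : ℝ) + k₀ := by positivity
    field_simp

/-- For all datasets `S`, `S'`: the mean increase of the loss at a training sample when this sample
is replaced in the training set. -/
theorem expect_loss_update_sub_le (hN : 0 < N) (hZ : 0 < Z)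
    (hW : IsMixingMatrix G W)
    (hc : ∀ ξ, StronglyConvex μ fun x => f x ξ) (hs : ∀ ξ, Smooth L fun x => f x ξ) (hμ : 0 < μ)
    (hL : 0 ≤ L) {k₀ : ℝ} (hk₀ : 2 + 4 * L ^ 2 / μ ^ 2 ≤ k₀)
    (x0 : Model d) (S S' : Dataset N Z Ξ) {a : ℝ} (ha : 0 < a) {k : ℕ}
    (hk : a * (μ * N * Z) ≤ k) :
    (𝔼 i : Fin N × Fin Z, 𝔼 I : Fin k → Fin N → Fin Z,
      (f (output f W (fun t => 1 / (μ * (t + k₀))) x0 (Function.update S i (S' i)) k I) (S i)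
        - f (output f W (fun t => 1 / (μ * (t + k₀))) x0 S k I) (S i))) ≤
      (3 + 36 * L ^ 2 / μ ^ 2) * (2 + 1 / (2 * a * μ) + 4 * L / μ + 2 * L / (a * μ ^ 2)) *
        (meanSqGrad f x0 S + meanSqGrad f x0 S') / (μ * N * Z) := by
  have : Nonempty (Fin Z) := ⟨⟨0, hZ⟩⟩
  have : Nonempty (Fin N) := ⟨⟨0, hN⟩⟩
  have hZ' : (1 : ℝ) ≤ Z := by exact_mod_cast hZ
  have hN' : (1 : ℝ) ≤ N := by exact_mod_cast hN
  have h2k : 2 ≤ k₀ := le_trans (by linarith [show 0 ≤ 4 * L ^ 2 / μ ^ 2 by positivity]) hk₀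
  have hstab := expect_sum_norm_localModels_update_sub_sq_le hN hZ hW hc hs hμ hL hk₀ x0 S S' k
  have hα := stepSize_pos hμ hk₀
  have h₁ := stepSize_mul_le_half hμ hk₀
  have h₂ := four_mul_stepSize_mul_sq_le hμ hk₀
  have hdist := expect_norm_localModels_sub_sq_le hW hc hs hμ hα h₁ h₂ x0 S k
  set α : ℕ → ℝ := fun t => 1 / (μ * (t + k₀)) with hαdef
  set w := meanSqGrad f x0 S with hw
  set w' := meanSqGrad f x0 S' with hw'
  have hw0 : 0 ≤ w := meanSqGrad_nonneg _ _ _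
  have hw0' : 0 ≤ w' := meanSqGrad_nonneg _ _ _
  set K := 3 + 36 * L ^ 2 / μ ^ 2 with hK
  have hK0 : 0 ≤ K := by positivity
  set M : ℝ := N * Z with hM
  have hM1 : 1 ≤ M := one_le_mul_of_one_le_of_one_le hN' hZ'
  have hM0 : 0 < M := by linarith
  set T : Fin N × Fin Z → (Fin k → Fin N → Fin Z) → ℝ := fun i I =>
    ∑ n, ‖localModels f W α x0 (Function.update S i (S' i)) k I n
      - localModels f W α x0 S k I n‖ with hT
  have hpoint : ∀ i I, f (output f W α x0 (Function.update S i (S' i)) k I) (S i)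
      - f (output f W α x0 S k I) (S i) ≤
      1 / (μ * M) * (2 * ‖∇ (fun y => f y (S i)) x0‖ ^ 2)
        + 1 / (μ * M) * (2 * L ^ 2) *
          ((N : ℝ)⁻¹ * ∑ n, ‖localModels f W α x0 S k I n - x0‖ ^ 2)
        + (μ * M / 4 + L) * (N : ℝ)⁻¹ ^ 2 * T i I ^ 2 := by
    intro i I
    set x := output f W α x0 S k I
    set x' := output f W α x0 (Function.update S i (S' i)) k I
    have h1 := sub_le_norm_gradient_mul (hc (S i)) (hs (S i)) hμ.le x x'
    have h2 : ‖x' - x‖ ^ 2 ≤ ((N : ℝ)⁻¹ * T i I) ^ 2 :=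
      pow_le_pow_left₀ (norm_nonneg _) (norm_output_sub_output_le x0 S _ k I) 2
    have h3 := (hs (S i)).norm_gradient_sq_le x x0
    have h4 := norm_output_sub_sq_le (f := f) (W := W) (α := α) hN x0 S k I
    set p := ‖∇ (fun y => f y (S i)) x‖
    set D := ‖x' - x‖
    -- The weight `μ * M` balances the two terms, as `D ^ 2` will be of order `1 / M ^ 2` in the
    -- mean.
    have h5 : p * D ≤ 1 / (μ * M) * p ^ 2 + μ * M / 4 * D ^ 2 := by
      rw [show 1 / (μ * M) * p ^ 2 + μ * M / 4 * D ^ 2 =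
        ((2 * p) ^ 2 + (μ * M * D) ^ 2) / (4 * (μ * M)) by field_simp; ring,
        le_div_iff₀ (by positivity)]
      nlinarith [sq_nonneg (2 * p - μ * M * D)]
    have h6 := mul_le_mul_of_nonneg_left h2 (show 0 ≤ μ * M / 4 + L by positivity)
    have h7 := mul_le_mul_of_nonneg_left (h3.trans (add_le_add_right
      (mul_le_mul_of_nonneg_left h4 (show 0 ≤ 2 * L ^ 2 by positivity)) _))
      (show 0 ≤ 1 / (μ * M) by positivity)
    rw [mul_pow] at h6
    linarith
  refine (Finset.expect_le_expect fun i _ =>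
    Finset.expect_le_expect fun I _ => hpoint i I).trans ?_
  simp_rw [Finset.expect_add_distrib, Fintype.expect_const, ← Finset.mul_expect]
  change 1 / (μ * M) * (2 * w) + _ + _ ≤ _
  have hs0 : 0 < a * (μ * M) := by positivity
  have hks : a * (μ * M) ≤ k + k₀ := by
    rw [hM, ← mul_assoc μ]
    linarith
  have hst2 : (N : ℝ)⁻¹ ^ 2 * (𝔼 i, 𝔼 I, T i I ^ 2) ≤
      (4 / μ ^ 2 + 2 / (a * μ ^ 3)) / M ^ 2 * (K * (w + w')) := by
    refine (mul_le_mul_of_nonneg_left hstab (by positivity)).trans ?_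
    rw [← mul_assoc]
    refine mul_le_mul_of_nonneg_right ?_ (by positivity)
    -- The lower bound on the horizon enters here: it brings the part `1 / (Z k)` of the stability
    -- bound down to the order `1 / Z ^ 2` of the other part.
    have h1 : 2 / (μ ^ 2 * Z * (k + k₀)) ≤ 2 / (μ ^ 2 * Z * (a * (μ * M))) := by gcongr
    refine (mul_le_mul_of_nonneg_left (add_le_add_right h1 _) (by positivity)).trans ?_
    rw [show (N : ℝ)⁻¹ ^ 2 * (4 / (μ ^ 2 * Z ^ 2) + 2 / (μ ^ 2 * Z * (a * (μ * M)))) =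
      (4 / μ ^ 2 + 2 / (a * μ ^ 3 * N)) / M ^ 2 by rw [hM]; field_simp]
    exact div_le_div_of_nonneg_right (add_le_add_right (div_le_div_of_nonneg_left zero_le_two
      (by positivity) (le_mul_of_one_le_right (by positivity) hN')) _) (by positivity)
  have hA := mul_le_mul_of_nonneg_left hst2 (show 0 ≤ μ * M / 4 + L by positivity)
  have hB := mul_le_mul_of_nonneg_left hdist
    (show 0 ≤ 1 / (μ * M) * (2 * L ^ 2) by positivity)
  rw [mul_assoc (μ * M / 4 + L)]
  refine (add_le_add (add_le_add_right hB _) hA).trans ?_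
  have hC : (μ * M / 4 + L) * ((4 / μ ^ 2 + 2 / (a * μ ^ 3)) / M ^ 2 * (K * (w + w'))) ≤
      K * (1 + 1 / (2 * a * μ) + 4 * L / μ + 2 * L / (a * μ ^ 2)) * (w + w') / (μ * M) := by
    -- Since `M ≥ 1`, the quadratic term with coefficient `L` is absorbed into the leading order.
    have h1 : μ * M / 4 + L ≤ (μ / 4 + L) * M := by nlinarith
    refine (mul_le_mul_of_nonneg_right h1 (by positivity)).trans (le_of_eq ?_)
    field_simp
    ring
  have hD : 1 / (μ * M) * (2 * w) + 1 / (μ * M) * (2 * L ^ 2) * (3 / μ ^ 2 * w) ≤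
      K * (w + w') / (μ * M) := by
    rw [show 1 / (μ * M) * (2 * w) + 1 / (μ * M) * (2 * L ^ 2) * (3 / μ ^ 2 * w) =
      (2 + 6 * (L ^ 2 / μ ^ 2)) * w / (μ * M) by ring]
    refine div_le_div_of_nonneg_right ?_ (by positivity)
    rw [hK, mul_div_assoc]
    have : 0 ≤ L ^ 2 / μ ^ 2 := by positivity
    gcongr
    · norm_num
    · norm_num
    · linarith
  refine (add_le_add hD hC).trans (le_of_eq ?_)
  rw [hM]
  ring

end Stability

/-! ### The empirical minimizer and the gradients near it -/

section Minimizer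

variable {d N Z : ℕ} {Ξ : Type*} {f : Model d → Ξ → ℝ} {μ L : ℝ}

theorem empLoss_eq_expect (f : Model d → Ξ → ℝ) (S : Dataset N Z Ξ) (x : Model d) :
    empLoss f S x = 𝔼 i, f x (S i) := by
  simp only [empLoss, localLoss, expect_prod_eq fun i => f x (S i),
    Fintype.expect_eq_sum_div_card, Fintype.card_fin, div_eq_inv_mul]

theorem continuous_empLoss (hs : ∀ ξ, Smooth L fun x => f x ξ) (S : Dataset N Z Ξ) :
    Continuous (empLoss f S) := by
  simp only [funext (empLoss_eq_expect f S), Fintype.expect_eq_sum_div_card]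
  exact (continuous_finsetSum _ fun i _ => (hs (S i)).1.continuous).div_const _

theorem empLoss_empMinimizer_le (hN : 0 < N) (hZ : 0 < Z) (hμ : 0 < μ)
    (hc : ∀ ξ, StronglyConvex μ fun x => f x ξ) (hs : ∀ ξ, Smooth L fun x => f x ξ)
    (S : Dataset N Z Ξ) (y : Model d) : empLoss f S (empMinimizer f S) ≤ empLoss f S y := by
  have : Nonempty (Fin N × Fin Z) := ⟨(⟨0, hN⟩, ⟨0, hZ⟩)⟩
  refine Classical.epsilon_spec (p := fun x => ∀ y, empLoss f S x ≤ empLoss f S y) ?_ y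
  refine (continuous_empLoss hs S).exists_forall_le' 0 ?_
  set b := 𝔼 i, ‖∇ (fun y => f y (S i)) 0‖ with hb
  -- Strong convexity at the origin makes the empirical loss coercive, so a minimizer exists and the
  -- choice in `empMinimizer` is a genuine one.
  have hlow : ∀ x : Model d, empLoss f S 0 - b * ‖x‖ + μ / 2 * ‖x‖ ^ 2 ≤ empLoss f S x := by
    intro x
    rw [empLoss_eq_expect, empLoss_eq_expect, hb, Finset.expect_mul,
      ← Finset.expect_sub_distrib, ← Fintype.expect_const (ι := Fin N × Fin Z)
        (μ / 2 * ‖x‖ ^ 2), ← Finset.expect_add_distrib]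
    refine Finset.expect_le_expect fun i _ => ?_
    have h1 := hc (S i) x 0
    have h2 := (abs_le.1 (abs_real_inner_le_norm (x - 0) (∇ (fun y => f y (S i)) 0))).1
    rw [sub_zero] at h1 h2
    linarith [mul_comm ‖x‖ ‖∇ (fun y => f y (S i)) 0‖]
  filter_upwards [(tendsto_norm_cocompact_atTop (E := Model d)).eventually_ge_atTop (2 * b / μ)]
    with x hx
  have h1 : 2 * b ≤ ‖x‖ * μ := (div_le_iff₀ hμ).1 hx
  have h2 := mul_le_mul_of_nonneg_right h1 (norm_nonneg x)
  nlinarith [hlow x]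

theorem gradient_empLoss_empMinimizer (hN : 0 < N) (hZ : 0 < Z) (hμ : 0 < μ)
    (hc : ∀ ξ, StronglyConvex μ fun x => f x ξ) (hs : ∀ ξ, Smooth L fun x => f x ξ)
    (S : Dataset N Z Ξ) : ∇ (empLoss f S) (empMinimizer f S) = 0 := by
  have h : IsLocalMin (empLoss f S) (empMinimizer f S) :=
    Filter.Eventually.of_forall fun y => empLoss_empMinimizer_le hN hZ hμ hc hs S y
  rw [gradient, h.fderiv_eq_zero, map_zero]

theorem meanSqGrad_le (hs : ∀ ξ, Smooth L fun x => f x ξ) [Nonempty (Fin N × Fin Z)]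
    (S : Dataset N Z Ξ) (x p : Model d) :
    meanSqGrad f x S ≤ 2 * meanSqGrad f p S + 2 * L ^ 2 * ‖x - p‖ ^ 2 := by
  refine (Finset.expect_le_expect fun i _ => (hs (S i)).norm_gradient_sq_le x p).trans
    (le_of_eq ?_)
  rw [Finset.expect_add_distrib, ← Finset.mul_expect, Fintype.expect_const, meanSqGrad]

/-- The mean squared sample gradient is controlled by the noise, the heterogeneity and the distance
to the empirical minimizer. -/
theorem meanSqGrad_le_of_noise_of_heterogeneity (hN : 0 < N) (hZ : 0 < Z) (hμ : 0 < μ)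
    (hc : ∀ ξ, StronglyConvex μ fun x => f x ξ) (hs : ∀ ξ, Smooth L fun x => f x ξ)
    {S : Dataset N Z Ξ} {σ δ : ℝ} (hσ : NoiseBound f S σ) (hδ : HeterogeneityBound f S δ)
    (x0 : Model d) :
    meanSqGrad f x0 S ≤
      4 * σ ^ 2 + 4 * δ ^ 2 + 2 * L ^ 2 * ‖x0 - empMinimizer f S‖ ^ 2 := by
  have : Nonempty (Fin N) := ⟨⟨0, hN⟩⟩
  have : Nonempty (Fin Z) := ⟨⟨0, hZ⟩⟩
  set p := empMinimizer f S with hp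
  have hgrad : ∇ (empLoss f S) p = 0 := gradient_empLoss_empMinimizer hN hZ hμ hc hs S
  have h1 : meanSqGrad f p S ≤ 2 * σ ^ 2 + 2 * δ ^ 2 := by
    -- At `p` the full gradient is zero, so a local gradient is a pure heterogeneity term and a
    -- sample gradient is noise plus heterogeneity.
    have h2 : ∀ i : Fin N × Fin Z, ‖∇ (fun y => f y (S i)) p‖ ^ 2 ≤
        2 * ‖∇ (fun y => f y (S i)) p - ∇ (localLoss f S i.1) p‖ ^ 2
          + 2 * ‖∇ (localLoss f S i.1) p - ∇ (empLoss f S) p‖ ^ 2 := by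
      intro i
      rw [hgrad, sub_zero]
      set u := ∇ (fun y => f y (S i)) p
      set v := ∇ (localLoss f S i.1) p
      have h3 := pow_le_pow_left₀ (norm_nonneg _) (norm_add_le (u - v) v) 2
      rw [sub_add_cancel] at h3
      nlinarith [sq_nonneg (‖u - v‖ - ‖v‖)]
    refine (Finset.expect_le_expect fun i _ => h2 i).trans ?_
    rw [Finset.expect_add_distrib, ← Finset.mul_expect, ← Finset.mul_expect]
    refine add_le_add (mul_le_mul_of_nonneg_left ?_ zero_le_two)
      (mul_le_mul_of_nonneg_left ?_ zero_le_two)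
    · rw [← Fintype.expect_const (ι := Fin N × Fin Z) (σ ^ 2), expect_prod_eq, expect_prod_eq]
      refine mul_le_mul_of_nonneg_left (Finset.sum_le_sum fun n _ => ?_) (by positivity)
      rw [Fintype.expect_const, Fintype.expect_eq_sum_div_card, Fintype.card_fin, div_eq_inv_mul]
      exact hσ p n
    · rw [expect_fst fun n => ‖∇ (localLoss f S n) p - ∇ (empLoss f S) p‖ ^ 2]
      exact hδ p
  linarith [meanSqGrad_le hs S x0 p]

end Minimizer

/-! ### Measurability in the data -/

section Measurability

variable {d N Z : ℕ} {Ξ : Type*} [MeasurableSpace Ξ] {f : Model d → Ξ → ℝ} {L : ℝ}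

/-- Each directional derivative is a pointwise limit of difference quotients with increments `1 /
n`, and an orthonormal basis reassembles the gradient. -/
theorem measurable_gradient_param (hf : ∀ x, Measurable (f x))
    (hs : ∀ ξ, Smooth L fun x => f x ξ) (x : Model d) :
    Measurable fun ξ => ∇ (fun y => f y ξ) x := by
  have hdir : ∀ v : Model d, Measurable fun ξ => inner ℝ v (∇ (fun y => f y ξ) x) := by
    intro v
    refine measurable_of_tendsto_metrizable
      (f := fun (n : ℕ) ξ => (n : ℝ) • (f (x + (n : ℝ)⁻¹ • v) ξ - f x ξ))
      (fun n => ((hf _).sub (hf _)).fun_const_smul _) (tendsto_pi_nhds.2 fun ξ => ?_)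
    have h := (((hs ξ).1 x).hasFDerivAt.lim_real v).comp (tendsto_natCast_atTop_atTop (R := ℝ))
    rwa [← inner_gradient_left, real_inner_comm] at h
  have e : (fun ξ => ∇ (fun y => f y ξ) x) = fun ξ => ∑ j,
      inner ℝ (EuclideanSpace.basisFun (Fin d) ℝ j) (∇ (fun y => f y ξ) x) •
        EuclideanSpace.basisFun (Fin d) ℝ j :=
    funext fun ξ => (OrthonormalBasis.sum_repr' _ _).symm
  rw [e]
  exact Finset.measurable_fun_sum _ fun j _ => (hdir _).smul_const _

theorem Smooth.continuous_gradient {g : Model d → ℝ} (hs : Smooth L g) : Continuous (∇ g) :=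
  (LipschitzWith.of_dist_le' fun x y => by
    rw [dist_eq_norm, dist_eq_norm]; exact hs.2 x y : LipschitzWith (Real.toNNReal L) _).continuous

theorem measurable_gradient_uncurry (hf : ∀ x, Measurable (f x))
    (hs : ∀ ξ, Smooth L fun x => f x ξ) :
    Measurable fun p : Model d × Ξ => ∇ (fun y => f y p.2) p.1 :=
  measurable_uncurry_of_continuous_of_measurable (u := fun x ξ => ∇ (fun y => f y ξ) x)
    (fun ξ => (hs ξ).continuous_gradient) fun x => measurable_gradient_param hf hs x

theorem measurable_loss_uncurry (hf : ∀ x, Measurable (f x))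
    (hs : ∀ ξ, Smooth L fun x => f x ξ) : Measurable fun p : Model d × Ξ => f p.1 p.2 :=
  measurable_uncurry_of_continuous_of_measurable (u := f) (fun ξ => (hs ξ).1.continuous) hf

theorem measurable_localModels (hf : ∀ x, Measurable (f x))
    (hs : ∀ ξ, Smooth L fun x => f x ξ) (W : Matrix (Fin N) (Fin N) ℝ) (α : ℕ → ℝ) (x0 : Model d)
    (k : ℕ) (I : Fin k → Fin N → Fin Z) (n : Fin N) :
    Measurable fun S : Dataset N Z Ξ => localModels f W α x0 S k I n := by
  induction k generalizing n with
  | zero => exact measurable_const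
  | succ k ih =>
    simp only [localModels]
    refine Finset.measurable_fun_sum _ fun m _ => Measurable.fun_const_smul ?_ _
    have h1 := ih (fun t => I t.castSucc) m
    refine h1.sub (Measurable.fun_const_smul ?_ _)
    exact (measurable_gradient_uncurry hf hs).comp (h1.prodMk (measurable_pi_apply _))

theorem measurable_output (hf : ∀ x, Measurable (f x))
    (hs : ∀ ξ, Smooth L fun x => f x ξ) (W : Matrix (Fin N) (Fin N) ℝ) (α : ℕ → ℝ) (x0 : Model d)
    (k : ℕ) (I : Fin k → Fin N → Fin Z) :
    Measurable fun S : Dataset N Z Ξ => output f W α x0 S k I := by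
  unfold output
  exact (Finset.measurable_fun_sum _ fun n _ =>
    measurable_localModels hf hs W α x0 k I n).fun_const_smul _

theorem measurable_meanSqGrad (hf : ∀ x, Measurable (f x))
    (hs : ∀ ξ, Smooth L fun x => f x ξ) (x0 : Model d) :
    Measurable fun S : Dataset N Z Ξ => meanSqGrad f x0 S := by
  simp only [meanSqGrad, Fintype.expect_eq_sum_div_card]
  exact (Finset.measurable_fun_sum _ fun i _ =>
    ((measurable_gradient_param hf hs x0).comp (measurable_pi_apply i)).norm.pow_const 2).div_const _

end Measurability

/-! ### Finite averages and integrals -/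

section Expectations

variable {Ω ι : Type*} [MeasurableSpace Ω] {P : Measure Ω} [Fintype ι] {F : ι → Ω → ℝ}

theorem integrable_expect (h : ∀ i, Integrable (F i) P) :
    Integrable (fun ω => 𝔼 i, F i ω) P := by
  simp only [Fintype.expect_eq_sum_div_card]
  exact (integrable_finsetSum _ fun i _ => h i).div_const _

theorem integral_expect (h : ∀ i, Integrable (F i) P) :
    ∫ ω, (𝔼 i, F i ω) ∂P = 𝔼 i, ∫ ω, F i ω ∂P := by
  simp only [Fintype.expect_eq_sum_div_card]
  rw [integral_div, integral_finsetSum _ fun i _ => h i]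

/-- Moment bounds are available only after averaging over samples or draws. As these are finite in
number, this passes to each of them, which is enough for integrability. -/
theorem le_card_mul_expect {g : ι → ℝ} (h : ∀ i, 0 ≤ g i) (i : ι) :
    g i ≤ Fintype.card ι * 𝔼 j, g j := by
  rw [Fintype.card_mul_expect]
  exact Finset.single_le_sum (fun j _ => h j) (Finset.mem_univ i)

end Expectations

/-! ### Exchange of samples and the law of the data -/

section Swap

variable {ι Ξ : Type*} [Fintype ι] [DecidableEq ι] [MeasurableSpace Ξ]

/-- Exchanging the `i`-th samples of two independent copies of a family of independent samples
preserves their joint law. -/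
theorem measurePreserving_exchange (D : ι → Measure Ξ) [∀ j, IsProbabilityMeasure (D j)] (i : ι) :
    MeasurePreserving
      (fun p : (ι → Ξ) × (ι → Ξ) => (Function.update p.1 i (p.2 i), Function.update p.2 i (p.1 i)))
      ((Measure.pi D).prod (Measure.pi D)) ((Measure.pi D).prod (Measure.pi D)) := by
  -- A pair of families is regrouped as a family of independent pairs. The exchange then acts
  -- coordinatewise: a swap of `D i × D i` at `i`, the identity elsewhere.
  have he := measurePreserving_arrowProdEquivProdArrow Ξ Ξ ι D D
  have hm : MeasurePreserving
      (fun (a : ι → Ξ × Ξ) j => (if j = i then Prod.swap else id : Ξ × Ξ → Ξ × Ξ) (a j))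
      (Measure.pi fun j => (D j).prod (D j)) (Measure.pi fun j => (D j).prod (D j)) := by
    refine measurePreserving_pi _ _ fun j => ?_
    split_ifs
    · exact Measure.measurePreserving_swap
    · exact MeasurePreserving.id _
  convert (he.comp hm).comp (he.symm _) using 1
  funext p
  refine Prod.ext (funext fun j => ?_) (funext fun j => ?_) <;>
  · by_cases h : j = i
    · subst h
      simp [MeasurableEquiv.arrowProdEquivProdArrow, Equiv.arrowProdEquivProdArrow]
    · simp [MeasurableEquiv.arrowProdEquivProdArrow, Equiv.arrowProdEquivProdArrow, h]

end Swap

/-- The majorant separates the model from the sample. It therefore dominates the loss both at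
training samples, where the two are dependent, and at independent copies. -/
theorem abs_loss_le {d : ℕ} {Ξ : Type*} {f : Model d → Ξ → ℝ} {μ L : ℝ}
    (hc : ∀ ξ, StronglyConvex μ fun x => f x ξ)
    (hs : ∀ ξ, Smooth L fun x => f x ξ) (hμ : 0 ≤ μ) (hL : 0 ≤ L) (x x0 : Model d) (ξ : Ξ) :
    |f x ξ| ≤ |f x0 ξ| + ‖∇ (fun y => f y ξ) x0‖ ^ 2 + (1 + L) * ‖x - x0‖ ^ 2 := by
  have h1 := abs_sub_le_norm_gradient_mul (hc ξ) (hs ξ) hμ hL x0 x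
  have h2 := abs_sub_abs_le_abs_sub (f x ξ) (f x0 ξ)
  nlinarith [sq_nonneg (‖∇ (fun y => f y ξ) x0‖ - ‖x - x0‖),
    sq_nonneg (‖∇ (fun y => f y ξ) x0‖), sq_nonneg ‖x - x0‖]

section DataLaw

variable {d N Z : ℕ} {Ξ : Type*} [MeasurableSpace Ξ] {D : Fin N → Measure Ξ}
  [∀ n, IsProbabilityMeasure (D n)]

instance : IsProbabilityMeasure (dataLaw Z D) := by
  unfold dataLaw; infer_instance

theorem measurePreserving_eval_dataLaw (i : Fin N × Fin Z) :
    MeasurePreserving (fun S : Dataset N Z Ξ => S i) (dataLaw Z D) (D i.1) :=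
  measurePreserving_eval (fun p : Fin N × Fin Z => D p.1) i

theorem measurePreserving_exchange_dataLaw (i : Fin N × Fin Z) :
    MeasurePreserving (fun p : Dataset N Z Ξ × Dataset N Z Ξ =>
      (Function.update p.1 i (p.2 i), Function.update p.2 i (p.1 i)))
      ((dataLaw Z D).prod (dataLaw Z D)) ((dataLaw Z D).prod (dataLaw Z D)) :=
  measurePreserving_exchange (fun p : Fin N × Fin Z => D p.1) i

/-- This writes the population loss as a mean over the same index set as the empirical loss, with a
fresh dataset, so that the two can be compared entry by entry. -/
theorem popLoss_eq_expect [Nonempty (Fin Z)] {f : Model d → Ξ → ℝ} (hf : ∀ x, Measurable (f x))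
    (x : Model d) :
    popLoss f D x = 𝔼 i : Fin N × Fin Z, ∫ S, f x (S i) ∂(dataLaw Z D) := by
  rw [popLoss, ← expect_fst (Z := Z)]
  refine Finset.expect_congr rfl fun i _ => ?_
  have h := measurePreserving_eval_dataLaw (Z := Z) (D := D) i
  rw [← h.map_eq, integral_map h.measurable.aemeasurable (hf x).aestronglyMeasurable]

end DataLaw

/-! ### Integrability of gradients, outputs and losses -/

section Integrability

variable {d N Z : ℕ} {Ξ : Type*} [MeasurableSpace Ξ] {D : Fin N → Measure Ξ}
  {f : Model d → Ξ → ℝ} {G : SimpleGraph (Fin N)}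
  {W : Matrix (Fin N) (Fin N) ℝ} {α : ℕ → ℝ} {μ L : ℝ}

theorem integrable_meanSqGrad [∀ n, IsProbabilityMeasure (D n)]
    (hN : 0 < N) (hZ : 0 < Z) (hμ : 0 < μ)
    (hf : ∀ x, Measurable (f x))
    (hc : ∀ ξ, StronglyConvex μ fun x => f x ξ) (hs : ∀ ξ, Smooth L fun x => f x ξ)
    {σ δ : ℝ} (hσ : ∀ᵐ S ∂(dataLaw Z D), NoiseBound f S σ)
    (hδ : ∀ᵐ S ∂(dataLaw Z D), HeterogeneityBound f S δ) {x0 : Model d}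
    (h0 : Integrable (fun S => ‖x0 - empMinimizer f S‖ ^ 2) (dataLaw Z D)) :
    Integrable (fun S => meanSqGrad f x0 S) (dataLaw Z D) := by
  refine Integrable.mono' ((integrable_const (4 * σ ^ 2 + 4 * δ ^ 2)).add
    (h0.const_mul (2 * L ^ 2))) (measurable_meanSqGrad hf hs x0).aestronglyMeasurable ?_
  filter_upwards [hσ, hδ] with S h1 h2
  rw [Real.norm_of_nonneg (meanSqGrad_nonneg _ _ _)]
  exact meanSqGrad_le_of_noise_of_heterogeneity hN hZ hμ hc hs h1 h2 x0

theorem integral_meanSqGrad_le [∀ n, IsProbabilityMeasure (D n)]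
    (hN : 0 < N) (hZ : 0 < Z) (hμ : 0 < μ)
    (hf : ∀ x, Measurable (f x))
    (hc : ∀ ξ, StronglyConvex μ fun x => f x ξ) (hs : ∀ ξ, Smooth L fun x => f x ξ)
    {σ δ : ℝ} (hσ : ∀ᵐ S ∂(dataLaw Z D), NoiseBound f S σ)
    (hδ : ∀ᵐ S ∂(dataLaw Z D), HeterogeneityBound f S δ) {x0 : Model d}
    (h0 : Integrable (fun S => ‖x0 - empMinimizer f S‖ ^ 2) (dataLaw Z D)) :
    ∫ S, meanSqGrad f x0 S ∂(dataLaw Z D) ≤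
      4 * σ ^ 2 + 4 * δ ^ 2 + 2 * L ^ 2 * ∫ S, ‖x0 - empMinimizer f S‖ ^ 2 ∂(dataLaw Z D) := by
  have h := integral_mono_ae (integrable_meanSqGrad hN hZ hμ hf hc hs hσ hδ h0)
    ((integrable_const (4 * σ ^ 2 + 4 * δ ^ 2)).add (h0.const_mul (2 * L ^ 2)))
    (by
      filter_upwards [hσ, hδ] with S h1 h2
      exact meanSqGrad_le_of_noise_of_heterogeneity hN hZ hμ hc hs h1 h2 x0)
  refine h.trans (le_of_eq ?_)
  simp only [Pi.add_apply]
  rw [integral_add (integrable_const _) (h0.const_mul _), integral_const, integral_const_mul]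
  simp

theorem integrable_norm_gradient_sq (hf : ∀ x, Measurable (f x))
    (hs : ∀ ξ, Smooth L fun x => f x ξ) {x0 : Model d}
    (hw : Integrable (fun S => meanSqGrad f x0 S) (dataLaw Z D)) (i : Fin N × Fin Z) :
    Integrable (fun S : Dataset N Z Ξ => ‖∇ (fun y => f y (S i)) x0‖ ^ 2) (dataLaw Z D) := by
  refine (hw.const_mul (Fintype.card (Fin N × Fin Z) : ℝ)).mono'
    (((measurable_gradient_param hf hs x0).comp
      (measurable_pi_apply i)).norm.pow_const 2).aestronglyMeasurable (ae_of_all _ fun S => ?_)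
  rw [Real.norm_of_nonneg (sq_nonneg _)]
  exact le_card_mul_expect (g := fun i => ‖∇ (fun y => f y (S i)) x0‖ ^ 2)
    (fun _ => sq_nonneg _) i

theorem integrable_norm_output_sub_sq [Nonempty (Fin Z)] (hN : 0 < N) (hW : IsMixingMatrix G W)
    (hf : ∀ x, Measurable (f x))
    (hc : ∀ ξ, StronglyConvex μ fun x => f x ξ) (hs : ∀ ξ, Smooth L fun x => f x ξ) (hμ : 0 < μ)
    (hα : ∀ t, 0 < α t) (h₁ : ∀ t, α t * μ ≤ 1 / 2) (h₂ : ∀ t, 4 * (α t * L ^ 2) ≤ μ)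
    {x0 : Model d} (hw : Integrable (fun S => meanSqGrad f x0 S) (dataLaw Z D))
    {k : ℕ} (I : Fin k → Fin N → Fin Z) :
    Integrable (fun S : Dataset N Z Ξ => ‖output f W α x0 S k I - x0‖ ^ 2) (dataLaw Z D) := by
  refine (hw.const_mul (Fintype.card (Fin k → Fin N → Fin Z) * (3 / μ ^ 2) : ℝ)).mono'
    (((measurable_output hf hs W α x0 k I).sub_const x0).norm.pow_const 2).aestronglyMeasurable
    (ae_of_all _ fun S => ?_)
  rw [Real.norm_of_nonneg (sq_nonneg _), mul_assoc]
  refine (le_card_mul_expect (g := fun I => ‖output f W α x0 S k I - x0‖ ^ 2)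
    (fun _ => sq_nonneg _) I).trans (mul_le_mul_of_nonneg_left ?_ (by positivity))
  refine (Finset.expect_le_expect fun I _ => norm_output_sub_sq_le hN x0 S k I).trans ?_
  rw [← Finset.mul_expect]
  exact expect_norm_localModels_sub_sq_le hW hc hs hμ hα h₁ h₂ x0 S k

theorem integrable_loss_eval [∀ n, IsProbabilityMeasure (D n)]
    (hfD : ∀ n x, Integrable (f x) (D n)) (x : Model d)
    (i : Fin N × Fin Z) :
    Integrable (fun S : Dataset N Z Ξ => f x (S i)) (dataLaw Z D) :=
  (measurePreserving_eval_dataLaw i).integrable_comp_of_integrable (hfD i.1 x)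

theorem integrable_loss_output [∀ n, IsProbabilityMeasure (D n)]
    (hf : ∀ x, Measurable (f x))
    (hfD : ∀ n x, Integrable (f x) (D n))
    (hc : ∀ ξ, StronglyConvex μ fun x => f x ξ) (hs : ∀ ξ, Smooth L fun x => f x ξ)
    (hμ : 0 ≤ μ) (hL : 0 ≤ L) {x0 : Model d}
    (hw : Integrable (fun S => meanSqGrad f x0 S) (dataLaw Z D)) {k : ℕ}
    {I : Fin k → Fin N → Fin Z}
    (hx : Integrable (fun S : Dataset N Z Ξ => ‖output f W α x0 S k I - x0‖ ^ 2) (dataLaw Z D))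
    (i : Fin N × Fin Z) :
    Integrable (fun S : Dataset N Z Ξ => f (output f W α x0 S k I) (S i)) (dataLaw Z D) := by
  refine (((integrable_loss_eval hfD x0 i).abs.add (integrable_norm_gradient_sq hf hs hw i)).add
    (hx.const_mul (1 + L))).mono' ?_ (ae_of_all _ fun S => ?_)
  · exact ((measurable_loss_uncurry hf hs).comp ((measurable_output hf hs W α x0 k I).prodMk
      (measurable_pi_apply i))).aestronglyMeasurable
  · exact abs_loss_le hc hs hμ hL _ x0 (S i)

theorem integrable_loss_output_prod [∀ n, IsProbabilityMeasure (D n)]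
    (hf : ∀ x, Measurable (f x))
    (hfD : ∀ n x, Integrable (f x) (D n))
    (hc : ∀ ξ, StronglyConvex μ fun x => f x ξ) (hs : ∀ ξ, Smooth L fun x => f x ξ)
    (hμ : 0 ≤ μ) (hL : 0 ≤ L) {x0 : Model d}
    (hw : Integrable (fun S => meanSqGrad f x0 S) (dataLaw Z D)) {k : ℕ}
    {I : Fin k → Fin N → Fin Z}
    (hx : Integrable (fun S : Dataset N Z Ξ => ‖output f W α x0 S k I - x0‖ ^ 2) (dataLaw Z D))
    (i : Fin N × Fin Z) :
    Integrable (fun p : Dataset N Z Ξ × Dataset N Z Ξ => f (output f W α x0 p.1 k I) (p.2 i))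
      ((dataLaw Z D).prod (dataLaw Z D)) := by
  refine ((((integrable_loss_eval hfD x0 i).abs.add
    (integrable_norm_gradient_sq hf hs hw i)).comp_snd (dataLaw Z D)).add
    ((hx.const_mul (1 + L)).comp_fst (dataLaw Z D))).mono' ?_ (ae_of_all _ fun p => ?_)
  · exact ((measurable_loss_uncurry hf hs).comp
      (((measurable_output hf hs W α x0 k I).comp measurable_fst).prodMk
      ((measurable_pi_apply i).comp measurable_snd))).aestronglyMeasurable
  · exact abs_loss_le hc hs hμ hL _ x0 (p.2 i)

end Integrability

/-! ### From the generalization gap to stability -/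

section Generalization

variable {d N Z : ℕ} {Ξ : Type*} [MeasurableSpace Ξ] {D : Fin N → Measure Ξ}
  [∀ n, IsProbabilityMeasure (D n)] {f : Model d → Ξ → ℝ}
  {W : Matrix (Fin N) (Fin N) ℝ} {α : ℕ → ℝ} {x0 : Model d} {k : ℕ} {I : Fin k → Fin N → Fin Z}

theorem genGap_eq_expect [Nonempty (Fin Z)] (hf : ∀ x, Measurable (f x)) (S : Dataset N Z Ξ) :
    genGap f D W α x0 k S I = 𝔼 i, ((∫ S' : Dataset N Z Ξ,
      f (output f W α x0 S k I) (S' i) ∂(dataLaw Z D)) - f (output f W α x0 S k I) (S i)) := by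
  rw [genGap, popLoss_eq_expect (Z := Z) hf, empLoss_eq_expect, Finset.expect_sub_distrib]

theorem integrable_genGap [Nonempty (Fin Z)] (hf : ∀ x, Measurable (f x))
    (h1 : ∀ i : Fin N × Fin Z,
      Integrable (fun S : Dataset N Z Ξ => f (output f W α x0 S k I) (S i)) (dataLaw Z D))
    (h2 : ∀ i, Integrable (fun p : Dataset N Z Ξ × Dataset N Z Ξ =>
      f (output f W α x0 p.1 k I) (p.2 i)) ((dataLaw Z D).prod (dataLaw Z D))) :
    Integrable (fun S => genGap f D W α x0 k S I) (dataLaw Z D) := by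
  simp_rw [genGap_eq_expect hf]
  exact integrable_expect fun i => (h2 i).integral_prod_left.sub (h1 i)

theorem integrable_loss_update
    (h2 : ∀ i, Integrable (fun p : Dataset N Z Ξ × Dataset N Z Ξ =>
      f (output f W α x0 p.1 k I) (p.2 i)) ((dataLaw Z D).prod (dataLaw Z D)))
    (i : Fin N × Fin Z) :
    Integrable (fun p : Dataset N Z Ξ × Dataset N Z Ξ =>
      f (output f W α x0 (Function.update p.1 i (p.2 i)) k I) (p.1 i))
      ((dataLaw Z D).prod (dataLaw Z D)) := by
  have h := (measurePreserving_exchange_dataLaw (D := D) i).integrable_comp_of_integrable (h2 i)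
  simpa [Function.comp_def] using h

/-- The mean generalization gap is the mean increase of the loss at a training sample when this
sample is replaced in the training set by an independent copy. -/
theorem integral_genGap_eq [Nonempty (Fin Z)] (hf : ∀ x, Measurable (f x))
    (h1 : ∀ i : Fin N × Fin Z,
      Integrable (fun S : Dataset N Z Ξ => f (output f W α x0 S k I) (S i)) (dataLaw Z D))
    (h2 : ∀ i, Integrable (fun p : Dataset N Z Ξ × Dataset N Z Ξ =>
      f (output f W α x0 p.1 k I) (p.2 i)) ((dataLaw Z D).prod (dataLaw Z D))) :
    ∫ S, genGap f D W α x0 k S I ∂(dataLaw Z D) =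
      ∫ p : Dataset N Z Ξ × Dataset N Z Ξ, (𝔼 i,
        (f (output f W α x0 (Function.update p.1 i (p.2 i)) k I) (p.1 i)
          - f (output f W α x0 p.1 k I) (p.1 i))) ∂((dataLaw Z D).prod (dataLaw Z D)) := by
  simp_rw [genGap_eq_expect hf]
  have h3 : ∀ i, Integrable (fun S : Dataset N Z Ξ => (∫ S' : Dataset N Z Ξ,
      f (output f W α x0 S k I) (S' i) ∂(dataLaw Z D)) - f (output f W α x0 S k I) (S i))
      (dataLaw Z D) := fun i => (h2 i).integral_prod_left.sub (h1 i)
  have h4 : ∀ i, Integrable (fun p : Dataset N Z Ξ × Dataset N Z Ξ =>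
      f (output f W α x0 (Function.update p.1 i (p.2 i)) k I) (p.1 i)
        - f (output f W α x0 p.1 k I) (p.1 i)) ((dataLaw Z D).prod (dataLaw Z D)) :=
    fun i => (integrable_loss_update h2 i).sub ((h1 i).comp_fst (dataLaw Z D))
  rw [integral_expect h3, integral_expect h4]
  refine Finset.expect_congr rfl fun i _ => ?_
  rw [integral_sub (h2 i).integral_prod_left (h1 i),
    integral_sub (integrable_loss_update h2 i) ((h1 i).comp_fst (dataLaw Z D))]
  congr 1
  · rw [← integral_prod _ (h2 i)]
    -- The exchange carries the loss of the run on `p.1` at the fresh sample `p.2 i` to the loss of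
    -- the modified run at the original sample `p.1 i`.
    have h := measurePreserving_exchange_dataLaw (D := D) i
    have h3 := (h2 i).aestronglyMeasurable
    rw [← h.map_eq] at h3
    have h4 := integral_map h.measurable.aemeasurable h3
    rw [h.map_eq] at h4
    simpa using h4
  · rw [integral_fun_fst fun S : Dataset N Z Ξ => f (output f W α x0 S k I) (S i)]
    simp

end Generalization

/-- Generalization bound with explicit constants. -/
theorem genError_le {d N Z : ℕ} {Ξ : Type*} [MeasurableSpace Ξ] {D : Fin N → Measure Ξ}
    [∀ n, IsProbabilityMeasure (D n)] {f : Model d → Ξ → ℝ} {G : SimpleGraph (Fin N)}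
    {W : Matrix (Fin N) (Fin N) ℝ} {μ L : ℝ} (hN : 0 < N) (hZ : 0 < Z)
    (hW : IsMixingMatrix G W) (hf : ∀ x, Measurable (f x))
    (hfD : ∀ n x, Integrable (f x) (D n))
    (hc : ∀ ξ, StronglyConvex μ fun x => f x ξ) (hs : ∀ ξ, Smooth L fun x => f x ξ) (hμ : 0 < μ)
    (hL : 0 ≤ L) {k₀ : ℝ} (hk₀ : 2 + 4 * L ^ 2 / μ ^ 2 ≤ k₀) {x0 : Model d}
    (hw : Integrable (fun S => meanSqGrad f x0 S) (dataLaw Z D)) {a : ℝ} (ha : 0 < a) {k : ℕ}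
    (hk : a * (μ * N * Z) ≤ k) :
    (∀ I, Integrable (fun S => genGap f D W (fun t => 1 / (μ * (t + k₀))) x0 k S I)
      (dataLaw Z D)) ∧
    genError Z f D W (fun t => 1 / (μ * (t + k₀))) x0 k ≤
      (3 + 36 * L ^ 2 / μ ^ 2) * (2 + 1 / (2 * a * μ) + 4 * L / μ + 2 * L / (a * μ ^ 2)) *
        (2 * ∫ S, meanSqGrad f x0 S ∂(dataLaw Z D)) / (μ * N * Z) := by
  have : Nonempty (Fin Z) := ⟨⟨0, hZ⟩⟩
  have hα := stepSize_pos hμ hk₀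
  have h₁ := stepSize_mul_le_half hμ hk₀
  have h₂ := four_mul_stepSize_mul_sq_le hμ hk₀
  set α : ℕ → ℝ := fun t => 1 / (μ * (t + k₀)) with hαdef
  have hx := fun I : Fin k → Fin N → Fin Z =>
    integrable_norm_output_sub_sq hN hW hf hc hs hμ hα h₁ h₂ hw I
  have hi1 := fun I => integrable_loss_output hf hfD hc hs hμ.le hL hw (hx I)
  have hi2 := fun I => integrable_loss_output_prod hf hfD hc hs hμ.le hL hw (hx I)
  have hgap := fun I => integrable_genGap hf (hi1 I) (hi2 I)
  refine ⟨hgap, ?_⟩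
  rw [genError, integral_expect hgap]
  simp_rw [fun I => integral_genGap_eq hf (hi1 I) (hi2 I)]
  have hi3 : ∀ I : Fin k → Fin N → Fin Z, Integrable
      (fun p : Dataset N Z Ξ × Dataset N Z Ξ => 𝔼 i,
        (f (output f W α x0 (Function.update p.1 i (p.2 i)) k I) (p.1 i)
          - f (output f W α x0 p.1 k I) (p.1 i))) ((dataLaw Z D).prod (dataLaw Z D)) :=
    fun I => integrable_expect fun i =>
      (integrable_loss_update (hi2 I) i).sub ((hi1 I i).comp_fst (dataLaw Z D))
  rw [← integral_expect hi3]
  set K := (3 + 36 * L ^ 2 / μ ^ 2) * (2 + 1 / (2 * a * μ) + 4 * L / μ + 2 * L / (a * μ ^ 2))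
  have hw1 : Integrable (fun p : Dataset N Z Ξ × Dataset N Z Ξ => meanSqGrad f x0 p.1)
      ((dataLaw Z D).prod (dataLaw Z D)) := hw.comp_fst (dataLaw Z D)
  have hw2 : Integrable (fun p : Dataset N Z Ξ × Dataset N Z Ξ => meanSqGrad f x0 p.2)
      ((dataLaw Z D).prod (dataLaw Z D)) := hw.comp_snd (dataLaw Z D)
  have hle := integral_mono (integrable_expect hi3)
    (((hw1.add hw2).const_mul K).div_const (μ * N * Z)) fun p => by
      rw [Finset.expect_comm]
      exact expect_loss_update_sub_le hN hZ hW hc hs hμ hL hk₀ x0 p.1 p.2 ha hk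
  refine hle.trans (le_of_eq ?_)
  rw [integral_div, integral_const_mul]
  simp only [Pi.add_apply]
  rw [integral_add hw1 hw2, integral_fun_fst fun S : Dataset N Z Ξ => meanSqGrad f x0 S,
    integral_fun_snd fun S : Dataset N Z Ξ => meanSqGrad f x0 S]
  simp [two_mul]

end DSGD

/-! ### Constants and conclusion -/

/-- This removes `μ` from the constant. With `ρ = L / μ`, the condition `2 + 4 * ρ ^ 2 ≤ k₀` bounds
`ρ` and `ρ ^ 2` by `k₀`, and any remaining `1 / μ` is `ρ / L`. -/
theorem DSGD.constant_le {L μ k₀ a : ℝ} (hL : 0 < L) (hμ : 0 < μ) (ha : 0 < a)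
    (hk₀ : 2 + 4 * L ^ 2 / μ ^ 2 ≤ k₀) :
    (3 + 36 * L ^ 2 / μ ^ 2) * (2 + 1 / (2 * a * μ) + 4 * L / μ + 2 * L / (a * μ ^ 2)) ≤
      (3 + 9 * k₀) * (2 + k₀ / (2 * a * L) + 4 * k₀ + 2 * k₀ / (a * L)) := by
  set ρ := L / μ with hρ
  have hρ0 : 0 < ρ := div_pos hL hμ
  have h1 : 2 + 4 * ρ ^ 2 ≤ k₀ := by rw [hρ, div_pow, ← mul_div_assoc]; exact hk₀
  have h2 : ρ ≤ k₀ := by nlinarith [sq_nonneg (ρ - 1)]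
  have h3 : ρ ^ 2 ≤ k₀ := by nlinarith
  have h4 : 0 < k₀ := by linarith
  have e1 : 36 * L ^ 2 / μ ^ 2 = 9 * (4 * ρ ^ 2) := by rw [hρ]; field_simp; norm_num
  have e2 : 1 / (2 * a * μ) = ρ / (2 * a * L) := by rw [hρ]; field_simp
  have e3 : 4 * L / μ = 4 * ρ := by rw [hρ]; ring
  have e4 : 2 * L / (a * μ ^ 2) = 2 * ρ ^ 2 / (a * L) := by rw [hρ]; field_simp
  rw [e1, e2, e3, e4]
  gcongr
  linarith

theorem theorem3 (L lam : ℝ) (hL : 0 < L) (hlam : 0 < lam) :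
    -- `κ` says how large `k₀` must be; it depends on `μ`, `L` and `λ` only
    ∃ κ : ℝ → ℝ, ∀ (k₀ a b : ℝ), 0 < a →
    -- the constant of the bound depends on `L`, `λ`, `k₀` and the constants in `k ≍ μNZ` only
    ∃ C : ℝ, 0 < C ∧
    ∀ (μ : ℝ), 0 < μ → 0 < k₀ → κ μ ≤ k₀ →
    ∀ (N Z d : ℕ), 0 < N → 0 < Z →
    ∀ (Ξ : Type*) [MeasurableSpace Ξ] (D : Fin N → Measure Ξ) [∀ n, IsProbabilityMeasure (D n)]
      (G : SimpleGraph (Fin N)) (W : Matrix (Fin N) (Fin N) ℝ)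
      (f : DSGD.Model d → Ξ → ℝ) (x0 : DSGD.Model d) (σ δ : ℝ) (k : ℕ),
    -- the network
    G.Connected → DSGD.IsMixingMatrix G W → DSGD.spectralGap W = lam →
    -- the loss
    (∀ x, Measurable (f x)) → (∀ n x, Integrable (f x) (D n)) →
    (∀ ξ, DSGD.StronglyConvex μ fun x => f x ξ) →
    (∀ ξ, DSGD.Smooth L fun x => f x ξ) →
    -- the data
    (∀ᵐ S ∂(DSGD.dataLaw Z D), DSGD.NoiseBound f S σ) →
    (∀ᵐ S ∂(DSGD.dataLaw Z D), DSGD.HeterogeneityBound f S δ) →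
    Integrable (fun S => ‖x0 - DSGD.empMinimizer f S‖ ^ 2) (DSGD.dataLaw Z D) →
    -- the horizon
    a * (μ * N * Z) ≤ k → k ≤ b * (μ * N * Z) →
    (∀ I, Integrable
      (fun S => DSGD.genGap f D W (fun t => 1 / (μ * (t + k₀))) x0 k S I) (DSGD.dataLaw Z D)) ∧
    DSGD.genError Z f D W (fun t => 1 / (μ * (t + k₀))) x0 k ≤
      C * (∫ S, ‖x0 - DSGD.empMinimizer f S‖ ^ 2 ∂(DSGD.dataLaw Z D)) / (μ * N * Z)
      + C * (σ ^ 2 * (1 + Real.log (N * Z))) / (μ * N * Z)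
      + C * δ ^ 2 / (μ * N * Z) := by
  refine ⟨fun μ => 2 + 4 * L ^ 2 / μ ^ 2, fun k₀ a b ha => ?_⟩
  -- The absolute values keep the constant positive before `k₀ > 0` is known. The factor `8 + 4 * L
  -- ^ 2` is twice the sum of `4` and `2 * L ^ 2`, the coefficients in `integral_meanSqGrad_le`; the
  -- `2` counts the two copies of the data.
  refine ⟨(3 + 9 * |k₀|) * (2 + |k₀| / (2 * a * L) + 4 * |k₀| + 2 * |k₀| / (a * L))
    * (8 + 4 * L ^ 2), by positivity, ?_⟩
  intro μ hμ hk₀ hκ N Z d hN hZ Ξ _ D _ G W f x0 σ δ k _ hW _ hf hfD hc hs hσ hδ h0 hk _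
  have hw := DSGD.integrable_meanSqGrad hN hZ hμ hf hc hs hσ hδ h0
  have hE := DSGD.integral_meanSqGrad_le hN hZ hμ hf hc hs hσ hδ h0
  obtain ⟨hint, hle⟩ := DSGD.genError_le hN hZ hW hf hfD hc hs hμ hL.le hκ hw ha hk
  refine ⟨hint, hle.trans ?_⟩
  have hK := DSGD.constant_le hL hμ ha hκ
  rw [abs_of_pos hk₀]
  set E := ∫ S, ‖x0 - DSGD.empMinimizer f S‖ ^ 2 ∂(DSGD.dataLaw Z D)
  have hE0 : 0 ≤ E := integral_nonneg fun S => sq_nonneg _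
  set K := (3 + 9 * k₀) * (2 + k₀ / (2 * a * L) + 4 * k₀ + 2 * k₀ / (a * L))
  have hK0 : 0 ≤ K := by positivity
  have hNZ : (1 : ℝ) ≤ N * Z := by exact_mod_cast Nat.mul_pos hN hZ
  have hlog : 0 ≤ Real.log (N * Z) := Real.log_nonneg hNZ
  have hw0 : 0 ≤ ∫ S, DSGD.meanSqGrad f x0 S ∂(DSGD.dataLaw Z D) :=
    integral_nonneg fun S => DSGD.meanSqGrad_nonneg f x0 S
  rw [← add_div, ← add_div]
  refine div_le_div_of_nonneg_right ?_ (by positivity)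
  refine (mul_le_mul hK (mul_le_mul_of_nonneg_left hE zero_le_two) (by positivity) hK0).trans ?_
  refine (mul_le_mul_of_nonneg_left ?_ hK0).trans (le_of_eq (show K * ((8 + 4 * L ^ 2) *
    (E + σ ^ 2 * (1 + Real.log (N * Z)) + δ ^ 2)) = _ by ring))
  -- The argument produces `σ ^ 2` with no logarithm; the factor `1 + log (N Z)` is at least one
  -- because `N Z ≥ 1`.
  have hσlog : 0 ≤ (8 + 4 * L ^ 2) * (σ ^ 2 * Real.log (N * Z)) := by positivity
  have h1 : 0 ≤ L ^ 2 * σ ^ 2 := by positivity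
  have h2 : 0 ≤ L ^ 2 * δ ^ 2 := by positivity
  linarith
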